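/- Let $d\in\{2,3\}$ and let $\Omega\subseteq\mathbb{R}^d$ be an open set. A conforming triangulation of $\overline\Omega$ is a finite simplicial complex with underlying set $\overline\Omega$ whose maximal simplices $K$ (the elements, $K\in\mathcal T$) are $d$-dimensional with $\operatorname{int}K\subseteq\Omega$ (this last inclusion is automatic if $\Omega$ is a bounded Lipschitz domain). For $K\in\mathcal T$ let $h_K=\operatorname{diam}K$ and let $\rho_K$ be the supremum of the diameters of balls contained in $K$. We write $\|\cdot\|_{r,U}$ for the norm of $L^r(U)$, $\|z\|_{0,r,U}=\|z\|_{r,U}$, $\|z\|_{1,r,U}=\|z\|_{r,U}+\|\nabla z\|_{r,U}$, and $X^r=(W^{1,r}(\Omega))^d$. Let $X=X^p$ with $p\in[1,\infty]$. Finite element spaces: for some $m,k\in\mathbb{N}_0$, $X_h$ is a linear subspace of $X$ consisting of vector fields continuous on $\overline\Omega$ whose components are polynomials of degree at most $m$ on each $K$; $Y_h$ is a linear space of functions which are polynomials of degree at most $k$ on each $K$; $Z_h$ is a finite-dimensional subspace of $H(\mathrm{div};\Omega)=\{z\in (L^2(\Omega))^d: \mathrm{div}\,z\in L^2(\Omega)\}$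 with $Z_h|_K\subseteq (W^{1,\infty}(K))^d$ for all $K\in\mathcal T$. A linear operator $\Sigma_h\colon X\to X_h+Z_h$ is a divergence reconstruction operator with constants $C(r)$, $r\in[1,\infty]$, if 1. (divergence preservation) $\mathrm{div}\,\Sigma_h z=0$ a.e. in $\Omega$ for every $z\in X$ with $\int_\Omega \mathrm{div}\,z\; y\,dx=0$ for all $y\in Y_h$; 2. (consistency) $\|z-\Sigma_h z\|_{j,r,K}\le C(r)\,h_K^{1-j}\,\|\nabla z\|_{r,K}$ for all $j\in\{0,1\}$, $r\in[1,\infty]$, $K\in\mathcal T$ and $z\in X\cap X^r$; 3. (stability of the divergence) $\|\mathrm{div}\,\Sigma_h z\|_{r,\Omega}\le C(r)\,\|\mathrm{div}\,z\|_{r,\Omega}$ for all $r\in[1,\infty)$ and $z\in X$ with $\mathrm{div}\,z\in L^r(\Omega)$. Let $r\in[1,\infty]$, and let the Sobolev exponent $r^*$ be $r^*=\frac{dr}{d-r}$ if $r<d$, any fixed number in $[1,\infty)$ if $r=d$, and $r^*=\infty$ if $r>d$. Let $\gamma_0\in\mathbb{R}$ and $C\colon[1,\infty]\to[0,\infty)$.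 Then there is a constant $c\ge 0$, depending only on $d$, $\Omega$, $\gamma_0$, $C$, $r$ and $r^*$ (the latter matters only if $r=d$), such that for every conforming triangulation $\mathcal T$ of $\overline\Omega$ with $h_K/\rho_K\le\gamma_0$ for all $K\in\mathcal T$, all $p$, $X_h$, $Y_h$, $Z_h$ as above, and every divergence reconstruction operator $\Sigma_h\colon X\to X_h+Z_h$ with constants $C$, $$\|\Sigma_h z\|_{r^*,\Omega}\le c\,\|z\|_{1,r,\Omega}\qquad\text{for every } z\in X\cap X^r .$$ In particular $c$ is independent of the mesh size. -/

import Mathlib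

open MeasureTheory Set
open scoped ENNReal NNReal ContDiff

noncomputable section

namespace DivReconstruction

/-- Euclidean space `ℝ^d`. -/
abbrev Space (d : ℕ) : Type := EuclideanSpace ℝ (Fin d)

/-! ### Weak derivatives and Sobolev spaces on an open set -/

/-- `φ` is a test function on `U`: smooth with compact support contained in `U`. -/
structure IsTest {d : ℕ} (U : Set (Space d)) (φ : Space d → ℝ) : Prop where
  smooth : ContDiff ℝ ∞ φ
  compact : HasCompactSupport φ
  supp : tsupport φ ⊆ U

/-- `g` is the weak gradient of the vector field `z` on `U`: both are locally integrable on `U`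
and `∫_U (∂_v φ) z = - ∫_U φ (∂_v z)` for all directions `v` and test functions `φ`,
where `∂_v z = g v`. -/
structure HasWeakGrad {d : ℕ} (U : Set (Space d)) (z : Space d → Space d)
    (g : Space d → Space d →L[ℝ] Space d) : Prop where
  loc : LocallyIntegrableOn z U
  loc_grad : LocallyIntegrableOn g U
  parts : ∀ φ : Space d → ℝ, IsTest U φ → ∀ v : Space d,
    ∫ x in U, (fderiv ℝ φ x v) • z x = - ∫ x in U, φ x • g x v

/-- `g` is the weak divergence of the vector field `z` on `U`: both are locally integrable on `U`
and `∫_U ∇φ · z = - ∫_U φ g` for all test functions `φ`. -/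
structure HasWeakDiv {d : ℕ} (U : Set (Space d)) (z : Space d → Space d)
    (g : Space d → ℝ) : Prop where
  loc : LocallyIntegrableOn z U
  loc_div : LocallyIntegrableOn g U
  parts : ∀ φ : Space d → ℝ, IsTest U φ →
    ∫ x in U, fderiv ℝ φ x (z x) = - ∫ x in U, φ x * g x

open Classical in
/-- The weak gradient of `z` on `U` (unique up to null sets), and `0` if there is none. -/
def weakGrad {d : ℕ} (U : Set (Space d)) (z : Space d → Space d) :
    Space d → Space d →L[ℝ] Space d :=
  if h : ∃ g, HasWeakGrad U z g then h.choose else 0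

open Classical in
/-- The weak divergence of `z` on `U` (unique up to null sets), and `0` if there is none. -/
def weakDiv {d : ℕ} (U : Set (Space d)) (z : Space d → Space d) : Space d → ℝ :=
  if h : ∃ g, HasWeakDiv U z g then h.choose else 0

/-- `z` belongs to `(W^{1,r}(U))^d`. -/
def MemSobolev {d : ℕ} (U : Set (Space d)) (r : ℝ≥0∞) (z : Space d → Space d) : Prop :=
  MemLp z r (volume.restrict U) ∧
    ∃ g, HasWeakGrad U z g ∧ MemLp g r (volume.restrict U)

/-- `z` belongs to `H(div; U)`. -/
def MemHdiv {d : ℕ} (U : Set (Space d)) (z : Space d → Space d) : Prop :=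
  MemLp z 2 (volume.restrict U) ∧
    ∃ g, HasWeakDiv U z g ∧ MemLp g 2 (volume.restrict U)

/-- The norm `‖z‖_{1,r,U} = ‖z‖_{r,U} + ‖∇z‖_{r,U}` (meaningful for `z` in `(W^{1,r}(U))^d`). -/
def sobolevNorm {d : ℕ} (U : Set (Space d)) (r : ℝ≥0∞) (z : Space d → Space d) : ℝ≥0∞ :=
  eLpNorm z r (volume.restrict U) + eLpNorm (weakGrad U z) r (volume.restrict U)

/-- Vector fields on `U` up to equality almost everywhere on `U`. -/
abbrev VField {d : ℕ} (U : Set (Space d)) : Type := Space d →ₘ[volume.restrict U] Space d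

lemma integrableOn_mul_of_loc {d : ℕ} {F : Type*} [NormedAddCommGroup F] [NormedSpace ℝ F]
    {U : Set (Space d)} {f : Space d → F} (hf : LocallyIntegrableOn f U)
    {ψ : Space d → ℝ} (hψ : Continuous ψ) (hc : HasCompactSupport ψ) (hs : tsupport ψ ⊆ U) :
    IntegrableOn (fun x => ψ x • f x) U := by
  have h1 : IntegrableOn (fun x => ψ x • f x) (tsupport ψ) :=
    IntegrableOn.continuousOn_smul (hf.integrableOn_compact_subset hs hc) hψ.continuousOn hc
  have h2 : Integrable (fun x => ψ x • f x) := by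
    rw [← integrableOn_iff_integrable_of_support_subset (s := tsupport ψ)]
    · exact h1
    · intro x hx
      apply subset_tsupport
      intro h0
      simp [h0] at hx
  exact h2.integrableOn

lemma IsTest.integrableOn_smul {d : ℕ} {F : Type*} [NormedAddCommGroup F] [NormedSpace ℝ F]
    {U : Set (Space d)} {f : Space d → F} (hf : LocallyIntegrableOn f U)
    {φ : Space d → ℝ} (hφ : IsTest U φ) : IntegrableOn (fun x => φ x • f x) U :=
  integrableOn_mul_of_loc hf hφ.smooth.continuous hφ.compact hφ.supp

lemma IsTest.integrableOn_fderiv_smul {d : ℕ} {F : Type*} [NormedAddCommGroup F]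
    [NormedSpace ℝ F] {U : Set (Space d)} {f : Space d → F}
    (hf : LocallyIntegrableOn f U) {φ : Space d → ℝ} (hφ : IsTest U φ) (v : Space d) :
    IntegrableOn (fun x => (fderiv ℝ φ x v) • f x) U := by
  refine integrableOn_mul_of_loc hf ?_ ?_ ?_
  · exact (hφ.smooth.continuous_fderiv (by simp)).clm_apply continuous_const
  · exact hφ.compact.fderiv_apply (𝕜 := ℝ) v
  · exact (tsupport_fderiv_apply_subset ℝ v).trans hφ.supp

lemma HasWeakGrad.congr {d : ℕ} {U : Set (Space d)} {z w : Space d → Space d}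
    {g : Space d → Space d →L[ℝ] Space d} (h : HasWeakGrad U z g)
    (hzw : z =ᵐ[volume.restrict U] w) : HasWeakGrad U w g where
  loc := h.loc.congr hzw
  loc_grad := h.loc_grad
  parts φ hφ v := by
    rw [← h.parts φ hφ v]
    refine integral_congr_ae ?_
    filter_upwards [hzw] with x hx
    rw [hx]

lemma locInt_add {d : ℕ} {G : Type*} [NormedAddCommGroup G] {U : Set (Space d)}
    {f g : Space d → G} (hf : LocallyIntegrableOn f U) (hg : LocallyIntegrableOn g U) :
    LocallyIntegrableOn (fun x => f x + g x) U :=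
  LocallyIntegrableOn.add hf hg

lemma locInt_zero {d : ℕ} {G : Type*} [NormedAddCommGroup G] (U : Set (Space d)) :
    LocallyIntegrableOn (fun _ => (0 : G)) U :=
  integrableOn_zero.locallyIntegrableOn

lemma memLp_fun_add {d : ℕ} {G : Type*} [NormedAddCommGroup G] {U : Set (Space d)} {r : ℝ≥0∞}
    {f g : Space d → G} (hf : MemLp f r (volume.restrict U)) (hg : MemLp g r (volume.restrict U)) :
    MemLp (fun x => f x + g x) r (volume.restrict U) :=
  MemLp.add hf hg

lemma memLp_fun_zero {d : ℕ} {G : Type*} [NormedAddCommGroup G] (U : Set (Space d)) (r : ℝ≥0∞) :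
    MemLp (fun _ => (0 : G)) r (volume.restrict U) :=
  MemLp.zero'

lemma HasWeakGrad.zero {d : ℕ} (U : Set (Space d)) :
    HasWeakGrad U (fun _ => 0) (fun _ => 0) where
  loc := locInt_zero U
  loc_grad := locInt_zero U
  parts φ _ v := by simp

lemma HasWeakGrad.add {d : ℕ} {U : Set (Space d)}
    {z w : Space d → Space d} {g k : Space d → Space d →L[ℝ] Space d}
    (hz : HasWeakGrad U z g) (hw : HasWeakGrad U w k) :
    HasWeakGrad U (fun x => z x + w x) (fun x => g x + k x) where
  loc := locInt_add hz.loc hw.loc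
  loc_grad := locInt_add hz.loc_grad hw.loc_grad
  parts φ hφ v := by
    have e1 : Integrable (fun x => (φ x • g x) v) (volume.restrict U) :=
      Integrable.apply_continuousLinearMap (hφ.integrableOn_smul hz.loc_grad) v
    have e2 : Integrable (fun x => (φ x • k x) v) (volume.restrict U) :=
      Integrable.apply_continuousLinearMap (hφ.integrableOn_smul hw.loc_grad) v
    have e3 : Integrable (fun x => (fderiv ℝ φ x v) • z x) (volume.restrict U) :=
      hφ.integrableOn_fderiv_smul hz.loc v
    have e4 : Integrable (fun x => (fderiv ℝ φ x v) • w x) (volume.restrict U) :=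
      hφ.integrableOn_fderiv_smul hw.loc v
    have l : ∫ x in U, (fderiv ℝ φ x v) • (z x + w x) =
        (∫ x in U, (fderiv ℝ φ x v) • z x) + ∫ x in U, (fderiv ℝ φ x v) • w x := by
      rw [← integral_add e3 e4]
      simp only [smul_add]
    have m : ∫ x in U, φ x • (g x + k x) v =
        (∫ x in U, φ x • g x v) + ∫ x in U, φ x • k x v := by
      simp only [smul_apply] at e1 e2
      rw [← integral_add e1 e2]
      simp only [smul_add, add_apply]
    rw [l, m, hz.parts φ hφ v, hw.parts φ hφ v, neg_add]

lemma HasWeakGrad.smul {d : ℕ} {U : Set (Space d)} (c : ℝ)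
    {z : Space d → Space d} {g : Space d → Space d →L[ℝ] Space d}
    (hz : HasWeakGrad U z g) : HasWeakGrad U (fun x => c • z x) (fun x => c • g x) where
  loc := LocallyIntegrableOn.smul hz.loc c
  loc_grad := LocallyIntegrableOn.smul hz.loc_grad c
  parts φ hφ v := by
    simp only [smul_apply]
    simp_rw [smul_comm _ c]
    rw [integral_smul, integral_smul, hz.parts φ hφ v, smul_neg]

lemma MemSobolev.congr {d : ℕ} {U : Set (Space d)} {r : ℝ≥0∞} {z w : Space d → Space d}
    (h : MemSobolev U r z) (hzw : z =ᵐ[volume.restrict U] w) : MemSobolev U r w := by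
  obtain ⟨hz, g, hg, hg'⟩ := h
  exact ⟨hz.ae_eq hzw, g, hg.congr hzw, hg'⟩

lemma MemSobolev.zero {d : ℕ} (U : Set (Space d)) (r : ℝ≥0∞) :
    MemSobolev U r (fun _ => 0) :=
  ⟨memLp_fun_zero U r, fun _ => 0, HasWeakGrad.zero U, memLp_fun_zero U r⟩

lemma MemSobolev.add {d : ℕ} {U : Set (Space d)} {r : ℝ≥0∞} {z w : Space d → Space d}
    (hz : MemSobolev U r z) (hw : MemSobolev U r w) : MemSobolev U r (fun x => z x + w x) := by
  obtain ⟨hz, g, hg, hg'⟩ := hz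
  obtain ⟨hw, k, hk, hk'⟩ := hw
  exact ⟨memLp_fun_add hz hw, fun x => g x + k x, hg.add hk, memLp_fun_add hg' hk'⟩

lemma MemSobolev.smul {d : ℕ} {U : Set (Space d)} {r : ℝ≥0∞} (c : ℝ) {z : Space d → Space d}
    (hz : MemSobolev U r z) : MemSobolev U r (fun x => c • z x) := by
  obtain ⟨hz, g, hg, hg'⟩ := hz
  exact ⟨MemLp.const_smul hz c, fun x => c • g x, hg.smul c, MemLp.const_smul hg' c⟩

/-- The Sobolev space `(W^{1,r}(U))^d`, for open `U`, as a space of vector fields up to equality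
almost everywhere. -/
def sobolevSpace {d : ℕ} (U : TopologicalSpace.Opens (Space d)) (r : ℝ≥0∞) :
    Submodule ℝ (VField (U : Set (Space d))) where
  carrier := {z | MemSobolev (U : Set (Space d)) r z}
  zero_mem' := (MemSobolev.zero _ r).congr AEEqFun.coeFn_zero.symm
  add_mem' {z w} hz hw := (MemSobolev.add hz hw).congr (AEEqFun.coeFn_add z w).symm
  smul_mem' c z hz := (MemSobolev.smul c hz).congr (AEEqFun.coeFn_smul c z).symm

/-! ### Triangulations -/

/-- The open simplex with vertex set `s`. -/
def openSimplex {d : ℕ} (s : Finset (Space d)) : Set (Space d) :=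
  interior (convexHull ℝ (s : Set (Space d)))

/-- The diameter `h_K` of the simplex `K` with vertex set `s`. -/
def elemDiam {d : ℕ} (s : Finset (Space d)) : ℝ :=
  Metric.diam (convexHull ℝ (s : Set (Space d)))

/-- The supremum `ρ_K` of the diameters of the balls contained in the simplex `K` with vertex
set `s`. -/
def inballDiam {d : ℕ} (s : Finset (Space d)) : ℝ :=
  sSup {t : ℝ | 0 ≤ t ∧ ∃ x : Space d,
    Metric.closedBall x (t / 2) ⊆ convexHull ℝ (s : Set (Space d))}

/-- `T` is a conforming triangulation of the closure of the open set `Ω`: a finite simplicial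
complex with underlying space `closure Ω`, all of whose maximal simplices (the elements) are
`d`-dimensional and have their interior in `Ω`. -/
structure IsTriangulation {d : ℕ} (Ω : Set (Space d))
    (T : Geometry.SimplicialComplex ℝ (Space d)) : Prop where
  finite : T.faces.Finite
  card_eq : ∀ s ∈ T.facets, s.card = d + 1
  space_eq : T.space = closure Ω
  interior_subset : ∀ s ∈ T.facets, openSimplex s ⊆ Ω

/-! ### Finite element spaces -/

/-- `z ∈ (ℙ^m_c(T))^d`: `z` is a.e. equal to a vector field that is continuous on `closure Ω` and
whose components are polynomials of degree at most `m` on each element. -/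
def MemContPoly {d : ℕ} (Ω : Set (Space d)) (T : Geometry.SimplicialComplex ℝ (Space d)) (m : ℕ)
    (z : VField Ω) : Prop :=
  ∃ f : Space d → Space d, z =ᵐ[volume.restrict Ω] f ∧ ContinuousOn f (closure Ω) ∧
    ∀ s ∈ T.facets, ∀ i : Fin d, ∃ P : MvPolynomial (Fin d) ℝ, P.totalDegree ≤ m ∧
      ∀ x ∈ convexHull ℝ (s : Set (Space d)), f x i = MvPolynomial.eval (fun j => x j) P

/-- `y ∈ ℙ^k(T)`: on each element, `y` is a.e. equal to a polynomial of degree at most `k`. -/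
def MemBrokenPoly {d : ℕ} (Ω : Set (Space d)) (T : Geometry.SimplicialComplex ℝ (Space d)) (k : ℕ)
    (y : Space d →ₘ[volume.restrict Ω] ℝ) : Prop :=
  ∀ s ∈ T.facets, ∃ P : MvPolynomial (Fin d) ℝ, P.totalDegree ≤ k ∧
    ∀ᵐ x ∂(volume.restrict (openSimplex s)), y x = MvPolynomial.eval (fun j => x j) P

/-- `Zh` is an `H(div; Ω)`-conforming finite element space with `Zh|_K ⊆ (W^{1,∞}(K))^d` for each
element `K`. -/
structure IsDivConforming {d : ℕ} (Ω : Set (Space d))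
    (T : Geometry.SimplicialComplex ℝ (Space d)) (Zh : Submodule ℝ (VField Ω)) : Prop where
  finiteDimensional : FiniteDimensional ℝ Zh
  memHdiv : ∀ z ∈ Zh, MemHdiv Ω z
  memSobolev : ∀ z ∈ Zh, ∀ s ∈ T.facets, MemSobolev (openSimplex s) ⊤ z

/-! ### Divergence reconstruction operators -/

/-- `S : X → Xh + Zh`, with `X = (W^{1,p}(Ω))^d`, is a divergence reconstruction operator with
constants `C r`, which may depend on the integrability exponent `r`. -/
structure IsReconstruction {d : ℕ} (Ω : TopologicalSpace.Opens (Space d))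
    (T : Geometry.SimplicialComplex ℝ (Space d)) (p : ℝ≥0∞)
    (Xh Zh : Submodule ℝ (VField (Ω : Set (Space d))))
    (Yh : Submodule ℝ (Space d →ₘ[volume.restrict (Ω : Set (Space d))] ℝ))
    (C : ℝ≥0∞ → ℝ≥0)
    (S : sobolevSpace Ω p →ₗ[ℝ] (Xh ⊔ Zh : Submodule ℝ (VField (Ω : Set (Space d))))) : Prop where
  /-- preservation of the divergence -/
  div_preserving : ∀ z : sobolevSpace Ω p,
    (∀ y ∈ Yh, ∫ x in (Ω : Set (Space d)), weakDiv Ω z.1 x * y x = 0) →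
    weakDiv Ω (S z).1 =ᵐ[volume.restrict (Ω : Set (Space d))] 0
  /-- consistency in `L^r(K)`: `‖z - S z‖_{r,K} ≤ C h_K ‖∇z‖_{r,K}` -/
  consistent_zero : ∀ r : ℝ≥0∞, 1 ≤ r → ∀ s ∈ T.facets, ∀ z : sobolevSpace Ω p,
    z.1 ∈ sobolevSpace Ω r →
    eLpNorm (z.1 - (S z).1) r (volume.restrict (openSimplex s)) ≤
      C r * ENNReal.ofReal (elemDiam s) *
        eLpNorm (weakGrad Ω z.1) r (volume.restrict (openSimplex s))
  /-- consistency in `W^{1,r}(K)`: `‖z - S z‖_{1,r,K} ≤ C ‖∇z‖_{r,K}` -/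
  consistent_one : ∀ r : ℝ≥0∞, 1 ≤ r → ∀ s ∈ T.facets, ∀ z : sobolevSpace Ω p,
    z.1 ∈ sobolevSpace Ω r →
    sobolevNorm (openSimplex s) r (z.1 - (S z).1) ≤
      C r * eLpNorm (weakGrad Ω z.1) r (volume.restrict (openSimplex s))
  /-- stability of the divergence -/
  div_stable : ∀ r : ℝ≥0∞, 1 ≤ r → r < ⊤ → ∀ z : sobolevSpace Ω p,
    MemLp (weakDiv Ω z.1) r (volume.restrict (Ω : Set (Space d))) →
    eLpNorm (weakDiv Ω (S z).1) r (volume.restrict (Ω : Set (Space d))) ≤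
      C r * eLpNorm (weakDiv Ω z.1) r (volume.restrict (Ω : Set (Space d)))

/-- `q` is an admissible value of the Sobolev exponent `r*` in dimension `d`: `q = dr / (d - r)`
if `r < d`, any `q ∈ [1, ∞)` if `r = d`, and `q = ∞` if `r > d`. -/
def IsSobolevExponent (d : ℕ) (r q : ℝ≥0∞) : Prop :=
  (r < d → q = d * r / (d - r)) ∧ (r = d → 1 ≤ q ∧ q < ⊤) ∧ (d < r → q = ⊤)

end DivReconstruction

end

open DivReconstruction

namespace DivReconstruction

noncomputable section

open Filter Topology

/-! ### Sobolev inequalities for smooth functions on the unit cube -/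

/-! Write `Σz = z - w` with `w = z - Σz`, and bound the two terms separately.

The term `z` is handled by a Sobolev embedding on `Ω`. No regularity of the boundary is needed: a
triangulated `Ω` is, up to a null set, a finite union of simplices, so the embedding follows from
the one on simplices (`IsTriangulation.exists_eLpNorm_le`). Its constant depends on the
triangulation, but it is taken from one triangulation fixed in advance, hence depends only on the
data allowed for `c`.

The term `w` must be estimated on the arbitrary mesh. With `τ = 1/r - 1/q`, scaling gives on a shape
regular simplex `K` of diameter `h` the bound `‖w‖_q ≤ B h^(-dτ) (‖w‖_r + h ‖∇w‖_r)`
(`IsCubeSobolevConst.exists_simplex`). The two consistency estimates bound the bracket by a multiple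
of `h ‖∇z‖_r`. Since `dτ ≤ 1` (`IsSobolevExponent.exists_ge`), the remaining factor `h^(1-dτ)` is at
most a power of the diameter of `Ω`. Because `r ≤ q`, the local bounds sum without loss in the
number of elements (`eLpNorm_le_mul_of_forall_restrict_le`), and so the constant is independent of
the mesh (`IsTriangulation.eLpNorm_le_of_consistent`).

The local inequality starts from smooth functions on the unit cube (`exists_eLpNorm_cube_le`:
Gagliardo-Nirenberg-Sobolev for `r < d`, Morrey for `r > d`). It is transported to parallelepipeds
by affine maps, extended to weakly differentiable fields by mollification
(`HasWeakGrad.eLpNorm_le_of_contDiff`), and carried to a simplex by covering it exactly with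
parallelepipeds, whose number is bounded in terms of `d` alone. -/

/-- Lebesgue measure on the unit cube. -/
def cubeMeasure (d : ℕ) : Measure (Fin d → ℝ) := Measure.pi fun _ => volume.restrict (Icc 0 1)

/-- The product form is the one required by `lintegral_prod_lintegral_pow_le`; the restricted form
serves changes of variables. -/
lemma cubeMeasure_eq (d : ℕ) : cubeMeasure d = volume.restrict (Icc 0 1) := by
  rw [cubeMeasure, ← Measure.restrict_pi_pi, ← pi_univ_Icc]
  rfl

instance (d : ℕ) : IsProbabilityMeasure (cubeMeasure d) := by
  have : IsProbabilityMeasure (volume.restrict (Icc (0 : ℝ) 1)) := ⟨by simp⟩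
  unfold cubeMeasure
  infer_instance

lemma ae_cubeMeasure_mem (d : ℕ) : ∀ᵐ x ∂(cubeMeasure d), x ∈ Icc (0 : Fin d → ℝ) 1 := by
  rw [cubeMeasure_eq]
  exact ae_restrict_mem measurableSet_Icc

lemma lintegral_cube_rpow_lt_top {d : ℕ} {F : Type*} [NormedAddCommGroup F] {u : (Fin d → ℝ) → F} (hu : Continuous u) {p : ℝ} (hp : 0 ≤ p) :
    ∫⁻ x, ‖u x‖ₑ ^ p ∂(cubeMeasure d) < ⊤ := by
  rw [cubeMeasure_eq]
  have h : IntegrableOn (fun x => ‖u x‖ ^ p) (Icc 0 1) :=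
    (hu.norm.rpow_const fun _ => Or.inr hp).integrableOn_Icc
  have h2 := h.hasFiniteIntegral
  rw [HasFiniteIntegral] at h2
  refine lt_of_eq_of_lt (lintegral_congr fun x => ?_) h2
  rw [Real.enorm_rpow_of_nonneg (norm_nonneg _) hp, enorm_norm]

section Cube

variable {d : ℕ} {F : Type*} [NormedAddCommGroup F] [NormedSpace ℝ F]

lemma enorm_sub_le_lintegral_deriv_unitInterval {f : ℝ → F}
    (hf : ContDiff ℝ 1 f) {s t : ℝ} (hs : s ∈ Icc (0 : ℝ) 1) (ht : t ∈ Icc (0 : ℝ) 1) :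
    ‖f s - f t‖ₑ ≤ ∫⁻ x in Icc (0 : ℝ) 1, ‖deriv f x‖ₑ := by
  wlog h : t ≤ s generalizing s t
  · rw [← enorm_neg, neg_sub]
    exact this ht hs (le_of_not_ge h)
  refine (enorm_sub_le_lintegral_deriv_of_contDiffOn_Icc hf.contDiffOn h).trans ?_
  exact lintegral_mono_set (Icc_subset_Icc ht.1 hs.2)

/-- Average `|f s| ≤ |f t| + ∫ |f'|` over `t`. Since `f` need not vanish at the endpoints, a zeroth
order term is unavoidable. -/
lemma enorm_le_lintegral_unitInterval {f : ℝ → F} (hf : ContDiff ℝ 1 f)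
    {s : ℝ} (hs : s ∈ Icc (0 : ℝ) 1) :
    ‖f s‖ₑ ≤ ∫⁻ t in Icc (0 : ℝ) 1, (‖f t‖ₑ + ‖deriv f t‖ₑ) := by
  have h1 : ‖f s‖ₑ = ∫⁻ _ in Icc (0 : ℝ) 1, ‖f s‖ₑ := by simp
  rw [lintegral_add_left' (by have := hf.continuous; fun_prop), h1]
  have h2 : ∫⁻ x in Icc (0 : ℝ) 1, ‖deriv f x‖ₑ =
      ∫⁻ _ in Icc (0 : ℝ) 1, ∫⁻ x in Icc (0 : ℝ) 1, ‖deriv f x‖ₑ := by simp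
  rw [h2, ← lintegral_add_right _ measurable_const]
  refine setLIntegral_mono' measurableSet_Icc fun t ht => ?_
  calc ‖f s‖ₑ = ‖f t + (f s - f t)‖ₑ := by simp
    _ ≤ ‖f t‖ₑ + ‖f s - f t‖ₑ := enorm_add_le _ _
    _ ≤ _ := by gcongr; exact enorm_sub_le_lintegral_deriv_unitInterval hf hs ht

open Function in
-- The case `r = 1` of the Sobolev inequality. Each of the `d` axis-parallel lines through `x`
-- bounds `|u x|` by a line integral; the product of these bounds, each to the power `1 / (d - 1)`,
-- is integrated by the grid-lines lemma.
lemma lintegral_cube_rpow_le {p : ℝ} (hp : Real.HolderConjugate d p)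
    {u : (Fin d → ℝ) → F} (hu : ContDiff ℝ 1 u) :
    ∫⁻ x, ‖u x‖ₑ ^ p ∂(cubeMeasure d) ≤
      (∫⁻ x, (‖u x‖ₑ + ‖fderiv ℝ u x‖ₑ) ∂(cubeMeasure d)) ^ p := by
  have hd : (1 : ℝ) ≤ (d : ℝ) - 1 := by
    have h2 : (2 : ℝ) ≤ d := by exact_mod_cast hp.lt
    linarith
  have hcu := hu.continuous
  have hcd := hu.continuous_fderiv one_ne_zero
  have hgrid := lintegral_prod_lintegral_pow_le (ι := Fin d) (A := fun _ => ℝ)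
    (fun _ => volume.restrict (Icc (0 : ℝ) 1)) (p := p) (by simpa using hp)
    (f := fun x => ‖u x‖ₑ + ‖fderiv ℝ u x‖ₑ) (by fun_prop)
  refine le_trans ?_ hgrid
  change _ ≤ ∫⁻ x, _ ∂(cubeMeasure d)
  refine lintegral_mono_ae ?_
  filter_upwards [ae_cubeMeasure_mem d] with x hx
  calc ‖u x‖ₑ ^ p = ∏ _i : Fin d, ‖u x‖ₑ ^ (1 / (d - 1 : ℝ)) := by
        rw [Finset.prod_const, ← ENNReal.rpow_natCast, ← ENNReal.rpow_mul, hp.conjugate_eq]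
        congr 1
        simp
        field_simp
    _ ≤ _ := by
        simp only [Fintype.card_fin]
        gcongr with i
        have hx' : x i ∈ Icc (0 : ℝ) 1 := ⟨hx.1 i, hx.2 i⟩
        have hc : ContDiff ℝ 1 (u ∘ update x i) := hu.comp (by convert! contDiff_update 1 x i)
        have h := enorm_le_lintegral_unitInterval hc hx'
        simp only [comp_apply, update_eq_self] at h
        refine h.trans ?_
        gcongr with t
        calc ‖deriv (u ∘ update x i) t‖ₑ
            = ‖fderiv ℝ u (update x i t) (deriv (update x i) t)‖ₑ := by
              rw [fderiv_comp_deriv _ (hu.differentiable one_ne_zero).differentiableAt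
                (hasDerivAt_update x i t).differentiableAt]
          _ ≤ ‖fderiv ℝ u (update x i t)‖ₑ * ‖deriv (update x i) t‖ₑ :=
              ContinuousLinearMap.le_opENorm _ _
          _ ≤ ‖fderiv ℝ u (update x i t)‖ₑ := by simp [deriv_update, Pi.enorm_single]

variable {G : Type*} [NormedAddCommGroup G] [InnerProductSpace ℝ G]

/-- The Gagliardo-Nirenberg-Sobolev inequality on the unit cube. -/
lemma exists_eLpNorm_cube_le_of_lt {p p' : ℝ≥0} (hp : 1 ≤ p) (hpd : (p : ℝ) < d)
    (hp' : (p' : ℝ)⁻¹ = (p : ℝ)⁻¹ - (d : ℝ)⁻¹) :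
    ∃ A : ℝ≥0, ∀ u : (Fin d → ℝ) → G, ContDiff ℝ 1 u →
      eLpNorm u p' (cubeMeasure d) ≤
        A * (eLpNorm u p (cubeMeasure d) + eLpNorm (fderiv ℝ u) p (cubeMeasure d)) := by
  set μ := cubeMeasure d
  have h0p : (0 : ℝ) < p := lt_of_lt_of_le one_pos hp
  have h0d : (0 : ℝ) < d := h0p.trans hpd
  have hp'0 : p' ≠ 0 := by
    rintro rfl
    have : (p : ℝ)⁻¹ - (d : ℝ)⁻¹ ≠ 0 := (sub_pos.2 ((inv_lt_inv₀ h0d h0p).2 hpd)).ne'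
    exact this (by simpa using hp'.symm)
  have h0n : (1 : ℝ) < d := lt_of_le_of_lt hp hpd
  let n' := Real.conjExponent d
  have hn : Real.HolderConjugate d n' := .conjExponent h0n
  have hdp : (0 : ℝ) < d - p := by linarith
  have hd1 : (0 : ℝ) < d - 1 := by linarith
  rcases hp.eq_or_lt with rfl | hp
  · refine ⟨1, fun u hu => ?_⟩
    have h : (p' : ℝ) = n' := by
      rw [← inv_inj, hp']
      simp [field, n', Real.conjExponent]
    have h1 := lintegral_cube_rpow_le hn hu
    rw [lintegral_add_left hu.continuous.enorm.measurable] at h1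
    rw [eLpNorm_nnreal_eq_lintegral hp'0, h, ENNReal.coe_one, eLpNorm_one_eq_lintegral_enorm,
      eLpNorm_one_eq_lintegral_enorm, one_mul, one_div, ENNReal.rpow_inv_le_iff hn.symm.pos]
    exact h1
  let q := Real.conjExponent p
  have hq : Real.HolderConjugate p q := .conjExponent hp
  have h0p : p ≠ 0 := zero_lt_one.trans hp |>.ne'
  have h1p : (p : ℝ) ≠ 1 := hq.lt.ne'
  have h3p : (p : ℝ) - 1 ≠ 0 := sub_ne_zero_of_ne h1p
  have h2q : 1 / n' - 1 / q = 1 / p' := by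
    simp_rw -zeta [one_div, hp']
    rw [← hq.one_sub_inv, ← hn.one_sub_inv, sub_sub_sub_cancel_left]
  -- The case `p = 1` will be applied to `|u| ^ γ`. This `γ` is the exponent for which both `γ n'`
  -- and, after Hölder's inequality, `(γ - 1) q` equal `p'`.
  let γ : ℝ≥0 := .mk (p * (d - 1) / (d - p)) (by positivity)
  have h0γ : (γ : ℝ) = p * (d - 1) / (d - p) := rfl
  have h1γ : 1 < (γ : ℝ) := by
    have : (1 : ℝ) < p := hp
    rw [h0γ, one_lt_div hdp]
    nlinarith
  have h2γ : γ * n' = p' := by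
    rw [← inv_inj, hp', h0γ, hn.conjugate_eq]
    simp [field]
  have h3γ : (γ - 1) * q = p' := by
    rw [← inv_inj, hp', h0γ, hq.conjugate_eq]
    have : (p : ℝ) * (d - 1) - (d - p) = d * (p - 1) := by ring
    simp [field, this]
  refine ⟨γ, fun u hu => ?_⟩
  -- The final step divides by a power of this integral, so it has to be nonzero and finite.
  by_cases h3u : ∫⁻ x, ‖u x‖ₑ ^ (p' : ℝ) ∂μ = 0
  · rw [eLpNorm_nnreal_eq_lintegral hp'0, h3u, ENNReal.zero_rpow_of_pos (by positivity)]
    exact zero_le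
  have hcu := hu.continuous
  have hcd := hu.continuous_fderiv one_ne_zero
  have h4u : ∫⁻ x, ‖u x‖ₑ ^ (p' : ℝ) ∂μ ≠ ⊤ := (lintegral_cube_rpow_lt_top hcu p'.coe_nonneg).ne
  have h5u : (∫⁻ x, ‖u x‖ₑ ^ (p' : ℝ) ∂μ) ^ (1 / q) ≠ 0 :=
    ENNReal.rpow_pos (pos_iff_ne_zero.mpr h3u) h4u |>.ne'
  have h6u : (∫⁻ x, ‖u x‖ₑ ^ (p' : ℝ) ∂μ) ^ (1 / q) ≠ ⊤ := by
    have := hq.symm.pos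
    exact ENNReal.rpow_ne_top_of_nonneg (by positivity) h4u
  let v : (Fin d → ℝ) → ℝ := fun x ↦ ‖u x‖ ^ (γ : ℝ)
  have hv : ContDiff ℝ 1 v := hu.norm_rpow h1γ
  have key : (∫⁻ x, ‖u x‖ₑ ^ (p' : ℝ) ∂μ) ^ (1 / n') ≤
      γ * (∫⁻ x, (‖u x‖ₑ + ‖fderiv ℝ u x‖ₑ) ^ (p : ℝ) ∂μ) ^ (1 / (p : ℝ)) *
      (∫⁻ x, ‖u x‖ₑ ^ (p' : ℝ) ∂μ) ^ (1 / q) := by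
    calc (∫⁻ x, ‖u x‖ₑ ^ (p' : ℝ) ∂μ) ^ (1 / n') = (∫⁻ x, ‖v x‖ₑ ^ n' ∂μ) ^ (1 / n') := by
          congr 2 with x
          rw [← h2γ, ENNReal.rpow_mul]
          change _ = ‖‖u x‖ ^ (γ : ℝ)‖ₑ ^ n'
          rw [Real.enorm_rpow_of_nonneg (norm_nonneg _) γ.coe_nonneg, enorm_norm]
      _ ≤ ∫⁻ x, (‖v x‖ₑ + ‖fderiv ℝ v x‖ₑ) ∂μ := by
          rw [one_div, ENNReal.rpow_inv_le_iff hn.symm.pos]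
          exact lintegral_cube_rpow_le hn hv
      _ ≤ ∫⁻ x, γ * (‖u x‖ₑ ^ ((γ : ℝ) - 1) * (‖u x‖ₑ + ‖fderiv ℝ u x‖ₑ)) ∂μ := by
          refine lintegral_mono fun x => ?_
          have e1 : ‖v x‖ₑ = ‖u x‖ₑ ^ ((γ : ℝ) - 1) * ‖u x‖ₑ := by
            change ‖‖u x‖ ^ (γ : ℝ)‖ₑ = _
            rw [Real.enorm_rpow_of_nonneg (norm_nonneg _) γ.coe_nonneg, enorm_norm]
            nth_rw 3 [← ENNReal.rpow_one ‖u x‖ₑ]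
            rw [← ENNReal.rpow_add_of_nonneg _ _ (by linarith) zero_le_one]
            simp
          have e2 : ‖fderiv ℝ v x‖ₑ ≤ γ * ‖u x‖ₑ ^ ((γ : ℝ) - 1) * ‖fderiv ℝ u x‖ₑ :=
            enorm_fderiv_norm_rpow_le (hu.differentiable one_ne_zero) h1γ
          have e3 : (1 : ℝ≥0∞) ≤ γ := by exact_mod_cast h1γ.le
          rw [mul_add, mul_add, ← mul_assoc (γ : ℝ≥0∞) _ ‖fderiv ℝ u x‖ₑ, e1]
          refine add_le_add (le_mul_of_one_le_left zero_le e3) ?_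
          exact e2
      _ = γ * ∫⁻ x, ‖u x‖ₑ ^ ((γ : ℝ) - 1) * (‖u x‖ₑ + ‖fderiv ℝ u x‖ₑ) ∂μ := by
          rw [lintegral_const_mul]
          fun_prop
      _ ≤ γ * ((∫⁻ x, (‖u x‖ₑ ^ ((γ : ℝ) - 1)) ^ q ∂μ) ^ (1 / q) *
            (∫⁻ x, (‖u x‖ₑ + ‖fderiv ℝ u x‖ₑ) ^ (p : ℝ) ∂μ) ^ (1 / (p : ℝ))) := by
          gcongr
          exact ENNReal.lintegral_mul_le_Lp_mul_Lq μ hq.symm (by fun_prop) (by fun_prop)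
      _ = _ := by
          simp_rw [← ENNReal.rpow_mul, h3γ]
          ring
  have hadd : (∫⁻ x, (‖u x‖ₑ + ‖fderiv ℝ u x‖ₑ) ^ (p : ℝ) ∂μ) ^ (1 / (p : ℝ)) ≤
      eLpNorm u p μ + eLpNorm (fderiv ℝ u) p μ := by
    rw [eLpNorm_nnreal_eq_lintegral h0p, eLpNorm_nnreal_eq_lintegral h0p]
    exact ENNReal.lintegral_Lp_add_le (by fun_prop) (by fun_prop) hp.le
  calc eLpNorm u p' μ = (∫⁻ x, ‖u x‖ₑ ^ (p' : ℝ) ∂μ) ^ (1 / (p' : ℝ)) :=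
        eLpNorm_nnreal_eq_lintegral hp'0
    _ ≤ γ * (∫⁻ x, (‖u x‖ₑ + ‖fderiv ℝ u x‖ₑ) ^ (p : ℝ) ∂μ) ^ (1 / (p : ℝ)) := by
        rw [← h2q, ENNReal.rpow_sub _ _ h3u h4u, ENNReal.div_le_iff h5u h6u]
        exact key
    _ ≤ _ := by gcongr

end Cube

/-! ### Morrey's inequality, and all exponents together, on the unit cube -/

section CubeMorrey

variable {d : ℕ} {F : Type*} [NormedAddCommGroup F] [NormedSpace ℝ F]

/-- The contraction by `t` towards `x` maps the convex cube into itself and has Jacobian `t ^ d`. -/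
lemma setLIntegral_cube_contraction_le {g : (Fin d → ℝ) → ℝ≥0∞} (hg : Measurable g)
    {x : Fin d → ℝ} (hx : x ∈ Icc (0 : Fin d → ℝ) 1) {t : ℝ} (ht : t ∈ Ioc (0 : ℝ) 1) :
    ∫⁻ y, g (x + t • (y - x)) ∂(cubeMeasure d) ≤
      ENNReal.ofReal (t ^ (-(d : ℝ))) * ∫⁻ y, g y ∂(cubeMeasure d) := by
  rw [cubeMeasure_eq]
  calc ∫⁻ y in Icc 0 1, g (x + t • (y - x))
      ≤ ∫⁻ y in Icc 0 1, (Icc (0 : Fin d → ℝ) 1).indicator g (t • y + (x - t • x)) := by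
        refine setLIntegral_mono' measurableSet_Icc fun y hy => ?_
        have e : x + t • (y - x) = t • y + (x - t • x) := by rw [smul_sub]; abel
        have hm : t • y + (x - t • x) ∈ Icc (0 : Fin d → ℝ) 1 := by
          rw [← e]
          exact (convex_Icc (0 : Fin d → ℝ) 1).add_smul_sub_mem hx hy ⟨ht.1.le, ht.2⟩
        rw [indicator_of_mem hm, e]
    _ ≤ ∫⁻ y, (Icc (0 : Fin d → ℝ) 1).indicator g (t • y + (x - t • x)) :=
        setLIntegral_le_lintegral _ _
    _ = ∫⁻ z, (Icc (0 : Fin d → ℝ) 1).indicator g (z + (x - t • x))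
          ∂(Measure.map (t • ·) volume) := by
        rw [lintegral_map]
        · exact (hg.indicator measurableSet_Icc).comp (measurable_add_const _)
        · exact measurable_const_smul t
    _ = ENNReal.ofReal (t ^ (-(d : ℝ))) *
          ∫⁻ z, (Icc (0 : Fin d → ℝ) 1).indicator g (z + (x - t • x)) := by
        rw [Measure.map_addHaar_smul _ ht.1.ne', lintegral_smul_measure, smul_eq_mul]
        congr 2
        rw [Module.finrank_fin_fun, abs_of_pos (by have := ht.1; positivity),
          Real.rpow_neg ht.1.le, Real.rpow_natCast]
    _ = _ := by
        rw [lintegral_add_right_eq_self, lintegral_indicator measurableSet_Icc]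

lemma lintegral_rpow_unitInterval_lt_top {a : ℝ} (ha : -1 < a) :
    ∫⁻ t in Ioc (0 : ℝ) 1, ENNReal.ofReal (t ^ a) < ⊤ := by
  have h : IntervalIntegrable (fun t : ℝ => t ^ a) volume 0 1 :=
    intervalIntegral.intervalIntegrable_rpow' ha
  rw [intervalIntegrable_iff_integrableOn_Ioc_of_le zero_le_one] at h
  exact h.lintegral_lt_top

/-- Integrate the derivative along the segment from `x` to `y`; in the sup norm its length is at
most `1`, so no factor appears. -/
lemma enorm_cube_le_lintegral_segment {u : (Fin d → ℝ) → F} (hu : ContDiff ℝ 1 u)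
    {x y : Fin d → ℝ} (hx : x ∈ Icc (0 : Fin d → ℝ) 1) (hy : y ∈ Icc (0 : Fin d → ℝ) 1) :
    ‖u x‖ₑ ≤ ‖u y‖ₑ + ∫⁻ t in Ioc (0 : ℝ) 1, ‖fderiv ℝ u (x + t • (y - x))‖ₑ := by
  have hl : ∀ t : ℝ, HasDerivAt (fun t : ℝ => x + t • (y - x)) (y - x) t := fun t => by
    simpa using ((hasDerivAt_id t).smul_const (y - x)).const_add x
  have hc : ContDiff ℝ 1 (fun t : ℝ => u (x + t • (y - x))) := hu.comp (by fun_prop)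
  have h := enorm_sub_le_lintegral_deriv_unitInterval hc (s := 0) (t := 1) (by simp) (by simp)
  have h1 : ‖y - x‖ₑ ≤ 1 := by
    rw [← enorm_one (G := ℝ)]
    refine enorm_le_iff_norm_le.2 ?_
    rw [norm_one, pi_norm_le_iff_of_nonneg zero_le_one]
    intro i
    rw [Real.norm_eq_abs, abs_le]
    have := hx.1 i; have := hx.2 i; have := hy.1 i; have := hy.2 i
    simp only [Pi.zero_apply, Pi.one_apply, Pi.sub_apply] at *
    constructor <;> linarith
  simp only [zero_smul, add_zero, one_smul, add_sub_cancel] at h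
  calc ‖u x‖ₑ = ‖u y + (u x - u y)‖ₑ := by simp
    _ ≤ ‖u y‖ₑ + ‖u x - u y‖ₑ := enorm_add_le _ _
    _ ≤ _ := by
      gcongr
      refine h.trans ?_
      rw [restrict_Ioc_eq_restrict_Icc]
      gcongr with t
      have : deriv (fun t : ℝ => u (x + t • (y - x))) t = fderiv ℝ u (x + t • (y - x)) (y - x) :=
        (((hu.differentiable one_ne_zero) _).hasFDerivAt.comp_hasDerivAt t (hl t)).deriv
      rw [this]
      refine (ContinuousLinearMap.le_opENorm _ _).trans ?_
      exact mul_le_of_le_one_right zero_le h1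

/-- Morrey's inequality on the unit cube. -/
lemma exists_eLpNorm_cube_le_of_gt {p : ℝ≥0} (hp : 1 ≤ p) (hpd : (d : ℝ) < p) :
    ∃ A : ℝ≥0, ∀ u : (Fin d → ℝ) → F, ContDiff ℝ 1 u →
      eLpNorm u ⊤ (cubeMeasure d) ≤
        A * (eLpNorm u p (cubeMeasure d) + eLpNorm (fderiv ℝ u) p (cubeMeasure d)) := by
  have h0p : (0 : ℝ) < p := lt_of_lt_of_le one_pos hp
  have hp0 : p ≠ 0 := by exact_mod_cast h0p.ne'
  -- This is where `d < p` enters: it makes `t ^ (-d / p)` integrable at `0`.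
  have ha : (-1 : ℝ) < -(d : ℝ) * (1 / p) := by
    rw [neg_mul, neg_lt_neg_iff, mul_one_div, div_lt_one h0p]
    exact hpd
  set J := ∫⁻ t in Ioc (0 : ℝ) 1, ENNReal.ofReal (t ^ (-(d : ℝ) * (1 / p))) with hJ
  have hJt : J ≠ ⊤ := (lintegral_rpow_unitInterval_lt_top ha).ne
  refine ⟨max 1 J.toNNReal, fun u hu => ?_⟩
  set μ := cubeMeasure d
  have hcu := hu.continuous
  have hcd := hu.continuous_fderiv one_ne_zero
  have hp1 : (1 : ℝ≥0∞) ≤ p := by exact_mod_cast hp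
  -- Average the segment estimate over `y`, exchange the integrals, pass from `L¹` to `L^p` in `y`
  -- on the probability space, and undo the contraction at the cost of `t ^ (-d / p)`.
  have hbound : ∀ x ∈ Icc (0 : Fin d → ℝ) 1,
      ‖u x‖ₑ ≤ eLpNorm u p μ + J * eLpNorm (fderiv ℝ u) p μ := by
    intro x hx
    calc ‖u x‖ₑ = ∫⁻ _, ‖u x‖ₑ ∂μ := by simp
      _ ≤ ∫⁻ y, (‖u y‖ₑ + ∫⁻ t in Ioc (0 : ℝ) 1, ‖fderiv ℝ u (x + t • (y - x))‖ₑ) ∂μ := by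
          refine lintegral_mono_ae ?_
          filter_upwards [ae_cubeMeasure_mem d] with y hy
          exact enorm_cube_le_lintegral_segment hu hx hy
      _ = eLpNorm u 1 μ + ∫⁻ y, (∫⁻ t in Ioc (0 : ℝ) 1, ‖fderiv ℝ u (x + t • (y - x))‖ₑ) ∂μ := by
          rw [lintegral_add_left hcu.enorm.measurable, eLpNorm_one_eq_lintegral_enorm]
      _ = eLpNorm u 1 μ + ∫⁻ t in Ioc (0 : ℝ) 1, ∫⁻ y, ‖fderiv ℝ u (x + t • (y - x))‖ₑ ∂μ := by
          congr 1
          refine lintegral_lintegral_swap ?_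
          refine Measurable.aemeasurable ?_
          refine (Continuous.enorm ?_).measurable
          exact hcd.comp (by fun_prop)
      _ ≤ eLpNorm u p μ + ∫⁻ t in Ioc (0 : ℝ) 1,
            ENNReal.ofReal (t ^ (-(d : ℝ) * (1 / p))) * eLpNorm (fderiv ℝ u) p μ := by
          refine add_le_add
            (eLpNorm_le_eLpNorm_of_exponent_le hp1 hcu.aestronglyMeasurable) ?_
          refine setLIntegral_mono' measurableSet_Ioc fun t ht => ?_
          have hct : Continuous fun y => fderiv ℝ u (x + t • (y - x)) := hcd.comp (by fun_prop)
          calc ∫⁻ y, ‖fderiv ℝ u (x + t • (y - x))‖ₑ ∂μ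
              = eLpNorm (fun y => fderiv ℝ u (x + t • (y - x))) 1 μ :=
                eLpNorm_one_eq_lintegral_enorm.symm
            _ ≤ eLpNorm (fun y => fderiv ℝ u (x + t • (y - x))) p μ :=
                eLpNorm_le_eLpNorm_of_exponent_le hp1 hct.aestronglyMeasurable
            _ = (∫⁻ y, ‖fderiv ℝ u (x + t • (y - x))‖ₑ ^ (p : ℝ) ∂μ) ^ (1 / (p : ℝ)) :=
                eLpNorm_nnreal_eq_lintegral hp0
            _ ≤ (ENNReal.ofReal (t ^ (-(d : ℝ))) *
                  ∫⁻ y, ‖fderiv ℝ u y‖ₑ ^ (p : ℝ) ∂μ) ^ (1 / (p : ℝ)) := by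
                gcongr
                exact setLIntegral_cube_contraction_le
                  (g := fun y => ‖fderiv ℝ u y‖ₑ ^ (p : ℝ)) (by fun_prop) hx ht
            _ = _ := by
                rw [ENNReal.mul_rpow_of_nonneg _ _ (by positivity),
                  ← eLpNorm_nnreal_eq_lintegral hp0,
                  ENNReal.ofReal_rpow_of_pos (Real.rpow_pos_of_pos ht.1 _),
                  ← Real.rpow_mul ht.1.le]
      _ = _ := by
          rw [lintegral_mul_const]
          exact ENNReal.measurable_ofReal.comp (by fun_prop)
  rw [eLpNorm_exponent_top]
  refine eLpNormEssSup_le_of_ae_enorm_bound ?_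
  filter_upwards [ae_cubeMeasure_mem d] with x hx
  refine (hbound x hx).trans ?_
  rw [mul_add]
  refine add_le_add ?_ ?_
  · exact le_mul_of_one_le_left zero_le (by exact_mod_cast le_max_left _ _)
  · gcongr
    rw [ENNReal.coe_max, ENNReal.coe_toNNReal hJt]
    exact le_max_right _ _

variable {G : Type*} [NormedAddCommGroup G] [InnerProductSpace ℝ G]

/-- The Sobolev inequality on the unit cube. -/
lemma exists_eLpNorm_cube_le (hd : 2 ≤ d) {r q : ℝ≥0∞} (hr : 1 ≤ r) (hrt : r ≠ ⊤)
    (hq : IsSobolevExponent d r q) :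
    ∃ A : ℝ≥0, ∀ u : (Fin d → ℝ) → G, ContDiff ℝ 1 u →
      eLpNorm u q (cubeMeasure d) ≤
        A * (eLpNorm u r (cubeMeasure d) + eLpNorm (fderiv ℝ u) r (cubeMeasure d)) := by
  lift r to ℝ≥0 using hrt
  have hd2 : (2 : ℝ) ≤ d := by exact_mod_cast hd
  have hr1 : 1 ≤ r := by exact_mod_cast hr
  have hr1' : (1 : ℝ) ≤ r := hr1
  rcases lt_trichotomy (r : ℝ) d with h | h | h
  · have hrd : r < (d : ℝ≥0) := by exact_mod_cast h
    have hq' : q = ((d * r / (d - r) : ℝ≥0) : ℝ≥0∞) := by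
      rw [hq.1 (by exact_mod_cast hrd), ENNReal.coe_div (tsub_pos_of_lt hrd).ne']
      simp
    rw [hq']
    refine exists_eLpNorm_cube_le_of_lt hr1 h ?_
    have : (r : ℝ) ≠ 0 := by positivity
    have : (d : ℝ) ≠ 0 := by positivity
    have : (d : ℝ) - r ≠ 0 := by linarith
    rw [NNReal.coe_div, NNReal.coe_sub hrd.le]
    push_cast
    field_simp
  · have hrd : r = (d : ℝ≥0) := by exact_mod_cast h
    obtain ⟨hq1, hqt⟩ := hq.2.1 (by exact_mod_cast hrd)
    lift q to ℝ≥0 using hqt.ne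
    -- In the borderline case, use the subcritical exponent `s < d` whose Sobolev exponent is `t ≥
    -- q`; `t ≥ d ≥ 2` guarantees `s ≥ 1`. The cube has measure `1`, so changing exponents costs
    -- nothing.
    set t : ℝ≥0 := max q d with ht
    have htd : (d : ℝ) ≤ t := by exact_mod_cast (le_max_right _ _ : (d : ℝ≥0) ≤ max q d)
    set s : ℝ≥0 := d * t / (d + t) with hs
    have hsr : (s : ℝ) = d * t / (d + t) := by simp [hs]
    have hsd : (s : ℝ) < d := by
      rw [hsr, div_lt_iff₀ (by positivity)]
      nlinarith
    have hs1 : (1 : ℝ) ≤ s := by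
      rw [hsr, le_div_iff₀ (by positivity)]
      nlinarith
    obtain ⟨A, hA⟩ := exists_eLpNorm_cube_le_of_lt (G := G) (p := s) (p' := t) (d := d)
      (by exact_mod_cast hs1) hsd (by
        have : (t : ℝ) ≠ 0 := by positivity
        have : (d : ℝ) ≠ 0 := by positivity
        rw [hsr]
        field_simp
        ring)
    refine ⟨A, fun u hu => ?_⟩
    have hcu := hu.continuous
    have hcd := hu.continuous_fderiv one_ne_zero
    have hsr' : (s : ℝ≥0∞) ≤ r := by
      have : s ≤ r := by rw [← NNReal.coe_le_coe, h]; exact hsd.le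
      exact_mod_cast this
    refine (eLpNorm_le_eLpNorm_of_exponent_le (q := t) (by exact_mod_cast le_max_left _ _)
      hcu.aestronglyMeasurable).trans ((hA u hu).trans ?_)
    gcongr
    · exact eLpNorm_le_eLpNorm_of_exponent_le hsr' hcu.aestronglyMeasurable
    · exact eLpNorm_le_eLpNorm_of_exponent_le hsr' hcd.aestronglyMeasurable
  · have hrd : (d : ℝ≥0) < r := by exact_mod_cast h
    rw [hq.2.2 (by exact_mod_cast hrd)]
    exact exists_eLpNorm_cube_le_of_gt hr1 h

end CubeMorrey

section Regularization

open ContinuousLinearMap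
open scoped Convolution

/-! ### Mollification -/

section Mollify

variable {E : Type*} [NormedAddCommGroup E] [NormedSpace ℝ E] [FiniteDimensional ℝ E]
  [MeasurableSpace E] [BorelSpace E] {μ : Measure E} [μ.IsAddHaarMeasure]
  {F : Type*} [NormedAddCommGroup F] [NormedSpace ℝ F]

/-- The mollifier is a probability density: `L¹ ≤ L^r` with respect to it at each point, then
Tonelli and translation invariance. -/
lemma eLpNorm_normed_convolution_le (φ : ContDiffBump (0 : E)) {f : E → F}
    (hf : AEStronglyMeasurable f μ) {r : ℝ≥0∞} (hr : 1 ≤ r) (hrt : r ≠ ⊤) :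
    eLpNorm (φ.normed μ ⋆[lsmul ℝ ℝ, μ] f : E → F) r μ ≤ eLpNorm f r μ := by
  wlog hsm : StronglyMeasurable f generalizing f
  · rw [convolution_congr _ (EventuallyEq.refl _ _) hf.ae_eq_mk, eLpNorm_congr_ae hf.ae_eq_mk]
    exact this hf.stronglyMeasurable_mk.aestronglyMeasurable hf.stronglyMeasurable_mk
  set ν := μ.withDensity fun t => ENNReal.ofReal (φ.normed μ t) with hν
  have hφm : Measurable fun t => ENNReal.ofReal (φ.normed μ t) :=
    ENNReal.measurable_ofReal.comp φ.continuous_normed.measurable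
  have hprob : IsProbabilityMeasure ν := by
    constructor
    rw [hν, withDensity_apply _ MeasurableSet.univ, Measure.restrict_univ,
      ← ofReal_integral_eq_lintegral_ofReal φ.integrable_normed (ae_of_all _ φ.nonneg_normed),
      φ.integral_normed, ENNReal.ofReal_one]
  have hr0 : r ≠ 0 := (one_pos.trans_le hr).ne'
  have hrpos : 0 < r.toReal := ENNReal.toReal_pos hr0 hrt
  have hpt : ∀ x, ‖(φ.normed μ ⋆[lsmul ℝ ℝ, μ] f : E → F) x‖ₑ ^ r.toReal ≤
      ∫⁻ t, ‖f (x - t)‖ₑ ^ r.toReal ∂ν := by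
    intro x
    have hsx : StronglyMeasurable fun t => f (x - t) :=
      hsm.comp_measurable (measurable_const_sub x)
    rw [← ENNReal.le_rpow_inv_iff hrpos, ← one_div]
    calc ‖(φ.normed μ ⋆[lsmul ℝ ℝ, μ] f : E → F) x‖ₑ
        ≤ ∫⁻ t, ‖φ.normed μ t • f (x - t)‖ₑ ∂μ := by
          rw [convolution_lsmul]
          exact enorm_integral_le_lintegral_enorm _
      _ = ∫⁻ t, ‖f (x - t)‖ₑ ∂ν := by
          rw [hν, lintegral_withDensity_eq_lintegral_mul _ hφm hsx.enorm]
          refine lintegral_congr fun t => ?_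
          rw [enorm_smul, Real.enorm_eq_ofReal (φ.nonneg_normed t)]
          rfl
      _ = eLpNorm (fun t => f (x - t)) 1 ν := eLpNorm_one_eq_lintegral_enorm.symm
      _ ≤ eLpNorm (fun t => f (x - t)) r ν :=
          eLpNorm_le_eLpNorm_of_exponent_le hr hsx.aestronglyMeasurable
      _ = _ := eLpNorm_eq_lintegral_rpow_enorm_toReal hr0 hrt
  rw [eLpNorm_eq_lintegral_rpow_enorm_toReal hr0 hrt, eLpNorm_eq_lintegral_rpow_enorm_toReal hr0 hrt]
  refine ENNReal.rpow_le_rpow ?_ (by positivity)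
  calc ∫⁻ x, ‖(φ.normed μ ⋆[lsmul ℝ ℝ, μ] f : E → F) x‖ₑ ^ r.toReal ∂μ
      ≤ ∫⁻ x, ∫⁻ t, ‖f (x - t)‖ₑ ^ r.toReal ∂ν ∂μ := lintegral_mono hpt
    _ = ∫⁻ t, ∫⁻ x, ‖f (x - t)‖ₑ ^ r.toReal ∂μ ∂ν := by
        refine lintegral_lintegral_swap (Measurable.aemeasurable ?_)
        exact ((hsm.comp_measurable (measurable_fst.sub measurable_snd)).enorm).pow_const _
    _ = ∫⁻ _, ∫⁻ x, ‖f x‖ₑ ^ r.toReal ∂μ ∂ν := by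
        refine lintegral_congr fun t => ?_
        exact lintegral_sub_right_eq_self (fun x => ‖f x‖ₑ ^ r.toReal) t
    _ = ∫⁻ x, ‖f x‖ₑ ^ r.toReal ∂μ := by simp

end Mollify

lemma IsTest.of_normed_sub {d : ℕ} {U : Set (Space d)} (φ : ContDiffBump (0 : Space d))
    {x : Space d} (hx : Metric.closedBall x φ.rOut ⊆ U) :
    IsTest U fun y => φ.normed volume (x - y) := by
  have hs : tsupport (fun y => φ.normed volume (x - y)) ⊆ Metric.closedBall x φ.rOut := by
    refine closure_minimal (fun y hy => ?_) Metric.isClosed_closedBall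
    have h : x - y ∈ Function.support (φ.normed volume) := hy
    rw [φ.support_normed_eq, mem_ball_zero_iff] at h
    rw [mem_closedBall_iff_norm']
    exact h.le
  refine ⟨?_, ?_, hs.trans hx⟩
  · exact (φ.contDiff_normed (n := ⊤)).comp (by fun_prop)
  · exact (isCompact_closedBall x φ.rOut).of_isClosed_subset (isClosed_tsupport _) hs

/-- The derivative falls on the kernel, and `y ↦ φ (x - y)` is an admissible test function because
the ball around `x` lies in `U`; two minus signs cancel. -/
lemma HasWeakGrad.fderiv_convolution {d : ℕ} {U : Set (Space d)} (hU : MeasurableSet U)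
    {u : Space d → Space d} {g : Space d → Space d →L[ℝ] Space d} (h : HasWeakGrad U u g)
    (hui : IntegrableOn u U) (φ : ContDiffBump (0 : Space d)) {x : Space d}
    (hx : Metric.closedBall x φ.rOut ⊆ U) :
    fderiv ℝ (φ.normed volume ⋆[lsmul ℝ ℝ, volume] U.indicator u : Space d → Space d) x =
      (φ.normed volume ⋆[lsmul ℝ ℝ, volume] U.indicator g :
        Space d → Space d →L[ℝ] Space d) x := by
  set f : Space d → ℝ := φ.normed volume with hf
  have hfc : ContDiff ℝ 1 f := φ.contDiff_normed
  have hfs : HasCompactSupport f := φ.hasCompactSupport_normed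
  have hui' : LocallyIntegrable (U.indicator u) :=
    (hui.integrable_indicator hU).locallyIntegrable
  have ht : IsTest U fun y => f (x - y) := IsTest.of_normed_sub φ hx
  have hd := hfs.hasFDerivAt_convolution_left (lsmul ℝ ℝ) hfc hui' x
  rw [hd.fderiv]
  have hfd : ∀ y v, fderiv ℝ (fun y => f (x - y)) y v = -fderiv ℝ f (x - y) v := by
    intro y v
    have h1 : HasFDerivAt (fun y => x - y) (-ContinuousLinearMap.id ℝ (Space d)) y :=
      (hasFDerivAt_id y).const_sub x
    have h2 := ((hfc.differentiable one_ne_zero) (x - y)).hasFDerivAt.comp y h1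
    have h3 : fderiv ℝ (fun y => f (x - y)) y =
        (fderiv ℝ f (x - y)).comp (-ContinuousLinearMap.id ℝ (Space d)) := h2.fderiv
    rw [h3]
    simp
  ext1 v
  have hl : (fderiv ℝ f ⋆[(lsmul ℝ ℝ).precompL (Space d), volume] U.indicator u) x v =
      ∫ y in U, (fderiv ℝ f (x - y) v) • u y := by
    have hex : ConvolutionExistsAt (fderiv ℝ f) (U.indicator u) x
        ((lsmul ℝ ℝ : ℝ →L[ℝ] Space d →L[ℝ] Space d).precompL (Space d)) volume :=
      (hfs.fderiv ℝ).convolutionExists_left _ (hfc.continuous_fderiv one_ne_zero) hui' x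
    have hex2 := hex.integrable_swap
    rw [convolution_eq_swap, ContinuousLinearMap.integral_apply hex2, ← integral_indicator hU]
    refine integral_congr_ae (ae_of_all _ fun y => ?_)
    by_cases hy : y ∈ U <;> simp [hy, precompL_apply]
  have hr : (f ⋆[lsmul ℝ ℝ, volume] U.indicator g : Space d → Space d →L[ℝ] Space d) x v =
      ∫ y in U, f (x - y) • g y v := by
    have e : (f ⋆[lsmul ℝ ℝ, volume] U.indicator g : Space d → Space d →L[ℝ] Space d) x =
        ∫ y in U, f (x - y) • g y := by
      rw [convolution_lsmul_swap, ← integral_indicator hU]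
      refine integral_congr_ae (ae_of_all _ fun y => ?_)
      by_cases hy : y ∈ U <;> simp [hy]
    rw [e, ContinuousLinearMap.integral_apply]
    · simp
    · exact ht.integrableOn_smul h.loc_grad
  rw [hl, hr]
  have hp := h.parts _ ht v
  simp only [hfd, neg_smul, integral_neg, neg_inj] at hp
  exact hp

/-- A Sobolev inequality on compact sets `Q n ⊆ U` for smooth functions carries over to weakly
differentiable functions on the limit of the sets `Q n`. -/
lemma HasWeakGrad.eLpNorm_le_of_contDiff {d : ℕ} {U : Set (Space d)} (hU : IsOpen U)
    (hUf : volume U ≠ ⊤) {u : Space d → Space d} {g : Space d → Space d →L[ℝ] Space d}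
    (h : HasWeakGrad U u g) {r q : ℝ≥0∞} (hr : 1 ≤ r) (hrt : r ≠ ⊤)
    (hur : MemLp u r (volume.restrict U)) (hgr : MemLp g r (volume.restrict U))
    {Q : ℕ → Set (Space d)} (hQ : ∀ n, IsCompact (Q n)) (hQU : ∀ n, Q n ⊆ U)
    {P : Set (Space d)} (hP : MeasurableSet P) (hPU : P ⊆ U)
    (hPQ : ∀ x ∈ P, ∀ᶠ n in atTop, x ∈ Q n) {B₁ B₂ : ℝ≥0∞}
    (hB : ∀ n, ∀ v : Space d → Space d, ContDiff ℝ 1 v →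
      eLpNorm v q (volume.restrict (Q n)) ≤ B₁ * eLpNorm v r (volume.restrict (Q n)) +
        B₂ * eLpNorm (fderiv ℝ v) r (volume.restrict (Q n))) :
    eLpNorm u q (volume.restrict P) ≤
      B₁ * eLpNorm u r (volume.restrict U) + B₂ * eLpNorm g r (volume.restrict U) := by
  have hUm := hU.measurableSet
  have : IsFiniteMeasure (volume.restrict U) := ⟨by simpa using hUf.lt_top⟩
  have hui : IntegrableOn u U := hur.integrable hr
  have hui' : LocallyIntegrable (U.indicator u) :=
    (hui.integrable_indicator hUm).locallyIntegrable
  -- The mollification radius stays within `U` on `Q n`, so that the gradient commutes with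
  -- mollification there, and tends to `0`.
  have hδ : ∀ n : ℕ, ∃ δ : ℝ, 0 < δ ∧ δ ≤ 1 / ((n : ℝ) + 1) ∧
      ∀ x ∈ Q n, Metric.closedBall x δ ⊆ U := by
    intro n
    obtain ⟨δ, hδ, hsub⟩ := (hQ n).exists_cthickening_subset_open hU (hQU n)
    refine ⟨min δ (1 / ((n : ℝ) + 1)), lt_min hδ (by positivity), min_le_right _ _,
      fun x hx => ?_⟩
    exact ((Metric.closedBall_subset_closedBall (min_le_left _ _)).trans
      (Metric.closedBall_subset_cthickening hx δ)).trans hsub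
  choose δ hδ0 hδ1 hδU using hδ
  -- The bounded ratio of outer to inner radius is what gives almost everywhere convergence of the
  -- mollifications.
  let φ : ℕ → ContDiffBump (0 : Space d) := fun n =>
    ⟨δ n / 2, δ n, half_pos (hδ0 n), half_lt_self (hδ0 n)⟩
  have hφ0 : Tendsto (fun n => (φ n).rOut) atTop (𝓝 0) :=
    squeeze_zero (fun n => (hδ0 n).le) hδ1 tendsto_one_div_add_atTop_nhds_zero_nat
  have hφK : ∀ᶠ n in atTop, (φ n).rOut ≤ 2 * (φ n).rIn :=
    Eventually.of_forall fun n => by change δ n ≤ 2 * (δ n / 2); linarith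
  have hae := ContDiffBump.ae_convolution_tendsto_right_of_locallyIntegrable (μ := volume)
    hφ0 hφK hui'
  let w : ℕ → Space d → Space d := fun n =>
    ((φ n).normed volume ⋆[lsmul ℝ ℝ, volume] U.indicator u : Space d → Space d)
  have hw : ∀ n, ContDiff ℝ 1 (w n) := fun n =>
    (φ n).hasCompactSupport_normed.contDiff_convolution_left _ (n := 1)
      (φ n).contDiff_normed hui'
  -- Lower semicontinuity of the `L^q` norm under almost everywhere convergence: no prior
  -- integrability of `u` in `L^q` is needed.
  refine Lp.eLpNorm_le_of_ae_tendsto (u := atTop) (f := fun n => (Q n).indicator (w n))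
    (Eventually.of_forall fun n => ?_) (fun n => ?_) ?_
  · have hQm := (hQ n).measurableSet
    calc eLpNorm ((Q n).indicator (w n)) q (volume.restrict P)
        ≤ eLpNorm ((Q n).indicator (w n)) q volume :=
          eLpNorm_mono_measure _ Measure.restrict_le_self
      _ = eLpNorm (w n) q (volume.restrict (Q n)) := eLpNorm_indicator_eq_eLpNorm_restrict hQm
      _ ≤ _ := hB n _ (hw n)
      _ ≤ _ := by
          gcongr
          · refine (eLpNorm_mono_measure _ Measure.restrict_le_self).trans ?_
            rw [← eLpNorm_indicator_eq_eLpNorm_restrict hUm]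
            exact eLpNorm_normed_convolution_le (φ n)
              (hui.integrable_indicator hUm).aestronglyMeasurable hr hrt
          · have he : eLpNorm (fderiv ℝ (w n)) r (volume.restrict (Q n)) =
                eLpNorm ((φ n).normed volume ⋆[lsmul ℝ ℝ, volume] U.indicator g :
                  Space d → Space d →L[ℝ] Space d) r (volume.restrict (Q n)) := by
              refine eLpNorm_congr_ae ?_
              filter_upwards [ae_restrict_mem hQm] with x hx
              exact h.fderiv_convolution hUm hui (φ n) (hδU n x hx)
            rw [he]
            refine (eLpNorm_mono_measure _ Measure.restrict_le_self).trans ?_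
            refine le_trans ?_ (eLpNorm_indicator_eq_eLpNorm_restrict (f := g) hUm).le
            exact eLpNorm_normed_convolution_le (φ n)
              ((aestronglyMeasurable_indicator_iff hUm).2 hgr.1) hr hrt
  · exact (hw n).continuous.aestronglyMeasurable.indicator (hQ n).measurableSet
  · filter_upwards [ae_restrict_of_ae hae, ae_restrict_mem hP] with x hx hxP
    rw [indicator_of_mem (hPU hxP)] at hx
    refine hx.congr' ?_
    filter_upwards [hPQ x hxP] with n hn
    rw [indicator_of_mem hn]

end Regularization

/-! ### Parallelepipeds -/

/-- `A` is a constant of the Sobolev inequality for smooth vector fields on the unit cube. -/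
def IsCubeSobolevConst (d : ℕ) (r q : ℝ≥0∞) (A : ℝ≥0) : Prop :=
  ∀ u : (Fin d → ℝ) → Space d, ContDiff ℝ 1 u →
    eLpNorm u q (cubeMeasure d) ≤
      A * (eLpNorm u r (cubeMeasure d) + eLpNorm (fderiv ℝ u) r (cubeMeasure d))

/-- The gain of integrability `1 / r - 1 / q`. -/
def expGap (r q : ℝ≥0∞) : ℝ := (1 / r).toReal - (1 / q).toReal

lemma expGap_nonneg {r q : ℝ≥0∞} (hr : 1 ≤ r) (hrq : r ≤ q) : 0 ≤ expGap r q := by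
  rw [expGap, sub_nonneg]
  refine ENNReal.toReal_mono ?_ ?_
  · simpa using (one_pos.trans_le hr).ne'
  · gcongr

variable {d : ℕ}

/-- The parallelepiped which is the image of the unit cube under `x ↦ b + M x`. -/
def parPiped (b : Space d) (M : (Fin d → ℝ) ≃L[ℝ] Space d) : Set (Space d) :=
  (fun x => b + M x) '' Icc 0 1

lemma parPiped_eq_image (b : Space d) (M : (Fin d → ℝ) ≃L[ℝ] Space d) :
    parPiped b M = (b + ·) '' (M '' Icc 0 1) := by
  rw [parPiped, image_image]

lemma isCompact_parPiped (b : Space d) (M : (Fin d → ℝ) ≃L[ℝ] Space d) :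
    IsCompact (parPiped b M) :=
  isCompact_Icc.image (by fun_prop)

lemma convex_parPiped (b : Space d) (M : (Fin d → ℝ) ≃L[ℝ] Space d) :
    Convex ℝ (parPiped b M) := by
  rw [parPiped_eq_image]
  exact ((convex_Icc _ _).linear_image M.toLinearEquiv.toLinearMap).translate b

lemma volume_parPiped (b : Space d) (M : (Fin d → ℝ) ≃L[ℝ] Space d) :
    volume (parPiped b M) = volume (M '' Icc 0 1) := by
  rw [parPiped_eq_image, image_add_left, measure_preimage_add]

lemma volume_image_cube_ne_top (M : (Fin d → ℝ) ≃L[ℝ] Space d) :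
    volume (M '' Icc 0 1) ≠ ⊤ :=
  (isCompact_Icc.image M.continuous).measure_ne_top

/-- By uniqueness of Haar measure the two measures are proportional; the image of the unit cube
determines the factor, without determinants. -/
lemma map_equiv_volume (M : (Fin d → ℝ) ≃L[ℝ] Space d) :
    volume (M '' Icc 0 1) ≠ 0 ∧
      Measure.map M volume = (volume (M '' Icc 0 1))⁻¹ • (volume : Measure (Space d)) := by
  have h := Measure.isAddLeftInvariant_eq_smul (Measure.map M volume) (volume : Measure (Space d))
  set c := (Measure.map M volume).addHaarScalarFactor (volume : Measure (Space d))
  have h1 : Measure.map M volume (M '' Icc 0 1) = 1 := by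
    change Measure.map M.toHomeomorph volume (M '' Icc 0 1) = 1
    rw [M.toHomeomorph.measurableEmbedding.map_apply]
    change volume (M ⁻¹' (M '' Icc 0 1)) = 1
    rw [preimage_image_eq _ M.injective, Real.volume_Icc_pi]
    simp
  have h2 : (c : ℝ≥0∞) * volume (M '' Icc 0 1) = 1 := by
    rw [← h1, h]
    rfl
  refine ⟨fun h0 => by simp [h0] at h2, ?_⟩
  rw [← ENNReal.eq_inv_of_mul_eq_one_left h2]
  exact h

/-- The cube inequality is transported through averaged norms; the powers of the volume that these
produce are the source of `expGap`. -/
lemma map_cubeMeasure (b : Space d) (M : (Fin d → ℝ) ≃L[ℝ] Space d) :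
    Measure.map (fun x => b + M x) (cubeMeasure d) =
      (volume (M '' Icc 0 1))⁻¹ • volume.restrict (parPiped b M) := by
  let e : (Fin d → ℝ) ≃ₜ Space d := M.toHomeomorph.trans (Homeomorph.addLeft b)
  have he : ∀ x, e x = b + M x := fun x => rfl
  have hpre : (e ⁻¹' parPiped b M) = Icc 0 1 := preimage_image_eq _ e.injective
  have hmap : Measure.map e volume =
      (volume (M '' Icc 0 1))⁻¹ • (volume : Measure (Space d)) := by
    have : (e : (Fin d → ℝ) → Space d) = (b + ·) ∘ M := rfl
    rw [this, ← Measure.map_map (measurable_const_add b) M.continuous.measurable,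
      (map_equiv_volume M).2, Measure.map_smul, map_add_left_eq_self]
  change Measure.map e _ = _
  have hcube : cubeMeasure d = volume.restrict (e ⁻¹' parPiped b M) := by
    rw [cubeMeasure_eq, hpre]
  rw [hcube, ← e.measurableEmbedding.restrict_map, hmap, Measure.restrict_smul]

lemma eLpNorm_comp_cube {F : Type*} [NormedAddCommGroup F] (b : Space d)
    (M : (Fin d → ℝ) ≃L[ℝ] Space d) {v : Space d → F} (hv : Continuous v) (r : ℝ≥0∞) :
    eLpNorm (fun x => v (b + M x)) r (cubeMeasure d) =
      (volume (M '' Icc 0 1))⁻¹ ^ (1 / r).toReal * eLpNorm v r (volume.restrict (parPiped b M)) := by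
  have hm : Continuous fun x => b + M x := by fun_prop
  rw [← smul_eq_mul, ← eLpNorm_smul_measure_of_ne_zero
    (ENNReal.inv_ne_zero.2 (volume_image_cube_ne_top M)), ← map_cubeMeasure,
    eLpNorm_map_measure hv.aestronglyMeasurable hm.measurable.aemeasurable]
  rfl

/-- The Sobolev inequality for smooth functions on a parallelepiped. -/
lemma IsCubeSobolevConst.eLpNorm_parPiped_le {r q : ℝ≥0∞} {A : ℝ≥0}
    (hA : IsCubeSobolevConst d r q A) (b : Space d) (M : (Fin d → ℝ) ≃L[ℝ] Space d)
    {v : Space d → Space d} (hv : ContDiff ℝ 1 v) :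
    eLpNorm v q (volume.restrict (parPiped b M)) ≤
      A * (volume (M '' Icc 0 1))⁻¹ ^ expGap r q *
        (eLpNorm v r (volume.restrict (parPiped b M)) +
          ‖(M : (Fin d → ℝ) →L[ℝ] Space d)‖ₑ *
            eLpNorm (fderiv ℝ v) r (volume.restrict (parPiped b M))) := by
  have hcd := hv.continuous_fderiv one_ne_zero
  have hM : ∀ x, HasFDerivAt (fun x => b + M x) (M : (Fin d → ℝ) →L[ℝ] Space d) x := fun x =>
    M.hasFDerivAt.const_add b
  have h := hA (fun x => v (b + M x)) (hv.comp (by fun_prop))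
  have hfd : eLpNorm (fderiv ℝ fun x => v (b + M x)) r (cubeMeasure d) ≤
      ‖(M : (Fin d → ℝ) →L[ℝ] Space d)‖ₑ *
        eLpNorm (fun x => fderiv ℝ v (b + M x)) r (cubeMeasure d) := by
    refine eLpNorm_le_nnreal_smul_eLpNorm_of_ae_le_mul
      (c := ‖(M : (Fin d → ℝ) →L[ℝ] Space d)‖₊) (ae_of_all _ fun x => ?_) r
    have : fderiv ℝ (fun x => v (b + M x)) x =
        (fderiv ℝ v (b + M x)).comp (M : (Fin d → ℝ) →L[ℝ] Space d) :=
      (((hv.differentiable one_ne_zero) _).hasFDerivAt.comp x (hM x)).fderiv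
    rw [this, mul_comm]
    exact ContinuousLinearMap.opNNNorm_comp_le _ _
  replace h := h.trans (mul_le_mul_right (add_le_add_right hfd _) _)
  rw [eLpNorm_comp_cube b M hv.continuous, eLpNorm_comp_cube b M hv.continuous,
    eLpNorm_comp_cube b M hcd] at h
  set κ := (volume (M '' Icc 0 1))⁻¹ with hκ
  have hκ0 : κ ≠ 0 := ENNReal.inv_ne_zero.2 (volume_image_cube_ne_top M)
  have hκt : κ ≠ ⊤ := ENNReal.inv_ne_top.2 (map_equiv_volume M).1
  have h0 : κ ^ (1 / q).toReal ≠ 0 := (ENNReal.rpow_pos (pos_iff_ne_zero.2 hκ0) hκt).ne'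
  have ht : κ ^ (1 / q).toReal ≠ ⊤ := ENNReal.rpow_ne_top_of_nonneg ENNReal.toReal_nonneg hκt
  rw [← ENNReal.mul_le_mul_iff_right h0 ht]
  refine h.trans (le_of_eq ?_)
  rw [expGap, ENNReal.rpow_sub _ _ hκ0 hκt]
  have : κ ^ (1 / r).toReal = κ ^ (1 / q).toReal * (κ ^ (1 / r).toReal / κ ^ (1 / q).toReal) :=
    (ENNReal.mul_div_cancel h0 ht).symm
  nth_rw 1 2 [this]
  ring

open scoped Pointwise in
/-- The Sobolev inequality for weakly differentiable functions on a parallelepiped contained in a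
set `K`. -/
lemma IsCubeSobolevConst.eLpNorm_parPiped_le_of_hasWeakGrad {r q : ℝ≥0∞} {A : ℝ≥0}
    (hA : IsCubeSobolevConst d r q A) (hr : 1 ≤ r) (hrt : r ≠ ⊤) (hrq : r ≤ q)
    {K : Set (Space d)} (hK : volume (interior K) ≠ ⊤)
    {u : Space d → Space d} {g : Space d → Space d →L[ℝ] Space d}
    (h : HasWeakGrad (interior K) u g)
    (hur : MemLp u r (volume.restrict (interior K)))
    (hgr : MemLp g r (volume.restrict (interior K)))
    (b : Space d) (M : (Fin d → ℝ) ≃L[ℝ] Space d) (hbM : parPiped b M ⊆ K) {κ H : ℝ≥0∞}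
    (hκ : κ ≤ volume (M '' Icc 0 1)) (hH : ‖(M : (Fin d → ℝ) →L[ℝ] Space d)‖ₑ ≤ H) :
    eLpNorm u q (volume.restrict (parPiped b M)) ≤
      A * (2 ^ d * κ⁻¹) ^ expGap r q *
        (eLpNorm u r (volume.restrict (interior K)) +
          H * eLpNorm g r (volume.restrict (interior K))) := by
  let e : (Fin d → ℝ) ≃ₜ Space d := M.toHomeomorph.trans (Homeomorph.addLeft b)
  have he : ∀ x, e x = b + M x := fun x => rfl
  have hIoo : interior (Icc (0 : Fin d → ℝ) 1) = pi univ fun _ => Ioo (0 : ℝ) 1 := by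
    rw [← pi_univ_Icc, interior_pi_set finite_univ]
    simp
  have hint : interior (parPiped b M) = e '' (pi univ fun _ => Ioo (0 : ℝ) 1) := by
    rw [← hIoo, e.image_interior]
    rfl
  have hres : volume.restrict (parPiped b M) = volume.restrict (interior (parPiped b M)) :=
    (Measure.restrict_congr_set
      (interior_ae_eq_of_null_frontier ((convex_parPiped b M).addHaar_frontier volume))).symm
  have hIU : interior (parPiped b M) ⊆ interior K := interior_mono hbM
  -- Exhaust the open parallelepiped by the images of `[ε, 1 - ε] ^ d`, compact subsets on which
  -- mollification works. Since `ε ≤ 1 / 4`, edges shrink by at most one half, which accounts for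
  -- the factor `2 ^ d`.
  let ε : ℕ → ℝ := fun n => 1 / ((n : ℝ) + 1 + 3)
  have hε0 : ∀ n, 0 < ε n := fun n => by positivity
  have hε1 : ∀ n, ε n ≤ 1 / 4 := fun n => by
    refine one_div_le_one_div_of_le (by norm_num) ?_
    have : (0 : ℝ) ≤ n := by positivity
    linarith
  have hεt : Tendsto ε atTop (𝓝 0) := by
    refine squeeze_zero (fun n => (hε0 n).le) (fun n => ?_) tendsto_one_div_add_atTop_nhds_zero_nat
    exact one_div_le_one_div_of_le (by positivity) (by linarith)
  have hl0 : ∀ n, 1 - 2 * ε n ≠ 0 := fun n => by linarith [hε1 n]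
  let Mn : ℕ → (Fin d → ℝ) ≃L[ℝ] Space d := fun n =>
    M.trans (ContinuousLinearEquiv.smulLeft (Units.mk0 (1 - 2 * ε n) (hl0 n)))
  have hMn : ∀ n x, Mn n x = (1 - 2 * ε n) • M x := fun n x => rfl
  let bn : ℕ → Space d := fun n => b + M (fun _ => ε n)
  have hpar : ∀ n, parPiped (bn n) (Mn n) = e '' (Icc (fun _ => ε n) (fun _ => 1 - ε n)) := by
    intro n
    have hl : 0 < 1 - 2 * ε n := by linarith [hε1 n]
    apply Subset.antisymm
    · rintro _ ⟨x, hx, rfl⟩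
      refine ⟨(fun _ => ε n) + (1 - 2 * ε n) • x, ⟨fun i => ?_, fun i => ?_⟩, ?_⟩
      · have := hx.1 i
        simp only [Pi.zero_apply, Pi.add_apply, Pi.smul_apply, smul_eq_mul] at *
        nlinarith
      · have := hx.2 i
        simp only [Pi.one_apply, Pi.add_apply, Pi.smul_apply, smul_eq_mul] at *
        nlinarith
      · simp only [he, hMn, bn, map_add, map_smul, add_assoc]
    · rintro _ ⟨x, hx, rfl⟩
      refine ⟨(1 - 2 * ε n)⁻¹ • (x - fun _ => ε n), ⟨fun i => ?_, fun i => ?_⟩, ?_⟩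
      · have := hx.1 i
        simp only [Pi.zero_apply, Pi.sub_apply, Pi.smul_apply, smul_eq_mul] at *
        exact mul_nonneg (inv_nonneg.2 hl.le) (sub_nonneg.2 this)
      · have := hx.2 i
        simp only [Pi.one_apply, Pi.sub_apply, Pi.smul_apply, smul_eq_mul] at *
        rw [inv_mul_le_iff₀ hl]
        linarith
      · simp only [he, hMn, bn, map_sub, map_smul, smul_smul, mul_inv_cancel₀ hl.ne', one_smul]
        abel
  rw [hres]
  have hmain := h.eLpNorm_le_of_contDiff isOpen_interior hK hr hrt hur hgr
    (q := q) (Q := fun n => parPiped (bn n) (Mn n)) (P := interior (parPiped b M))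
    (fun n => isCompact_parPiped _ _) (fun n => ?_) isOpen_interior.measurableSet hIU ?_
    (B₁ := A * (2 ^ d * κ⁻¹) ^ expGap r q) (B₂ := A * (2 ^ d * κ⁻¹) ^ expGap r q * H)
    (fun n v hv => ?_)
  · refine hmain.trans (le_of_eq ?_)
    ring
  · rw [hpar n]
    refine Subset.trans ?_ hIU
    rw [hint]
    refine image_mono fun x hx i _ => ?_
    have h1 := hx.1 i
    have h2 := hx.2 i
    have := hε0 n
    exact ⟨by linarith, by linarith⟩
  · intro x hx
    rw [hint] at hx
    obtain ⟨y, hy, rfl⟩ := hx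
    have : ∀ i, ∀ᶠ n in atTop, ε n ≤ y i ∧ y i ≤ 1 - ε n := by
      intro i
      have hyi := hy i (mem_univ i)
      have h1 := hεt.eventually (gt_mem_nhds hyi.1)
      have h2 := hεt.eventually (gt_mem_nhds (sub_pos.2 hyi.2))
      filter_upwards [h1, h2] with n h1 h2
      exact ⟨h1.le, by linarith⟩
    filter_upwards [eventually_all.2 this] with n hn
    rw [hpar n]
    exact mem_image_of_mem _ ⟨fun i => (hn i).1, fun i => (hn i).2⟩
  · refine (hA.eLpNorm_parPiped_le (bn n) (Mn n) hv).trans ?_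
    have hl : 1 / 2 ≤ 1 - 2 * ε n := by linarith [hε1 n]
    have hvol : volume (Mn n '' Icc 0 1) =
        ENNReal.ofReal ((1 - 2 * ε n) ^ d) * volume (M '' Icc 0 1) := by
      have : Mn n '' Icc 0 1 = (1 - 2 * ε n) • (M '' Icc 0 1) := by
        rw [← image_smul, image_image]
        rfl
      rw [this, Measure.addHaar_smul_of_nonneg _ (by linarith)]
      simp
    have hκn : (volume (Mn n '' Icc 0 1))⁻¹ ≤ 2 ^ d * κ⁻¹ := by
      rw [hvol]
      have h2 : ((2 : ℝ≥0∞) ^ d * κ⁻¹) = (ENNReal.ofReal ((1 / 2) ^ d) * κ)⁻¹ := by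
        rw [ENNReal.mul_inv (Or.inl (by simp)) (Or.inl ENNReal.ofReal_ne_top),
          ENNReal.ofReal_pow (by norm_num), one_div, ENNReal.ofReal_inv_of_pos two_pos,
          ← ENNReal.inv_pow, inv_inv]
        simp
      rw [h2]
      gcongr
    have hHn : ‖(Mn n : (Fin d → ℝ) →L[ℝ] Space d)‖ₑ ≤ H := by
      refine le_trans ?_ hH
      have : (Mn n : (Fin d → ℝ) →L[ℝ] Space d) =
          (1 - 2 * ε n) • (M : (Fin d → ℝ) →L[ℝ] Space d) := by
        ext1 x
        rfl
      rw [this, enorm_smul]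
      refine mul_le_of_le_one_left zero_le ?_
      rw [Real.enorm_eq_ofReal (by linarith), ENNReal.ofReal_le_one]
      linarith [hε0 n]
    have hτ := expGap_nonneg hr hrq
    rw [mul_assoc _ H, ← mul_add]
    gcongr

/-! ### Lebesgue norms over finite unions -/

section LpSums

variable {α : Type*} [MeasurableSpace α] {μ : Measure α} {F G : Type*} [NormedAddCommGroup F]
  [NormedAddCommGroup G]

lemma eLpNorm_restrict_union_le (f : α → F) {q : ℝ≥0∞} (hq : 1 ≤ q) (s t : Set α) :
    eLpNorm f q (μ.restrict (s ∪ t)) ≤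
      eLpNorm f q (μ.restrict s) + eLpNorm f q (μ.restrict t) := by
  by_cases hqt : q = ⊤
  · subst hqt
    simp only [eLpNorm_exponent_top]
    refine eLpNormEssSup_le_of_ae_enorm_bound ?_
    rw [ae_restrict_union_iff]
    constructor
    · filter_upwards [enorm_ae_le_eLpNormEssSup f (μ.restrict s)] with x hx
      exact hx.trans le_self_add
    · filter_upwards [enorm_ae_le_eLpNormEssSup f (μ.restrict t)] with x hx
      exact hx.trans le_add_self
  · have hq0 : q ≠ 0 := (one_pos.trans_le hq).ne'
    have hq1 : 1 ≤ q.toReal := by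
      rw [← ENNReal.toReal_one]
      exact ENNReal.toReal_mono hqt hq
    simp only [eLpNorm_eq_lintegral_rpow_enorm_toReal hq0 hqt]
    refine (ENNReal.rpow_le_rpow (lintegral_union_le _ s t) (by positivity)).trans ?_
    exact ENNReal.rpow_add_le_add_rpow _ _ (by positivity) ((div_le_one (by positivity)).2 hq1)

/-- Pieces may overlap here, and the number of terms enters the bound. It is applied to the cells of
one simplex and to the elements of a fixed triangulation. -/
lemma eLpNorm_restrict_biUnion_le {ι : Type*} (f : α → F) {q : ℝ≥0∞} (hq : 1 ≤ q) (s : Finset ι)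
    (P : ι → Set α) :
    eLpNorm f q (μ.restrict (⋃ i ∈ s, P i)) ≤ ∑ i ∈ s, eLpNorm f q (μ.restrict (P i)) := by
  classical
  induction s using Finset.induction_on with
  | empty => simp
  | insert a s ha ih =>
    rw [Finset.set_biUnion_insert, Finset.sum_insert ha]
    exact (eLpNorm_restrict_union_le f hq _ _).trans (by gcongr)

lemma sum_rpow_le_rpow_sum {ι : Type*} (s : Finset ι) (a : ι → ℝ≥0∞) {p : ℝ} (hp : 1 ≤ p) :
    ∑ i ∈ s, a i ^ p ≤ (∑ i ∈ s, a i) ^ p := by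
  classical
  induction s using Finset.induction_on with
  | empty => simp
  | insert b s hb ih =>
    rw [Finset.sum_insert hb, Finset.sum_insert hb]
    exact (add_le_add_right ih _).trans (ENNReal.add_rpow_le_rpow_add _ _ hp)

/-- The embedding of `ℓ^r` into `ℓ^q` for `r ≤ q` has norm one, so the constant `M` survives
summation over any number of disjoint pieces. -/
lemma eLpNorm_le_mul_of_forall_restrict_le {ι : Type*} {s : Finset ι} {P : ι → Set α} {U : Set α}
    (hP : ∀ i ∈ s, MeasurableSet (P i)) (hd : (s : Set ι).PairwiseDisjoint P)
    (hPU : ∀ i ∈ s, P i ⊆ U) (hU : U ≤ᵐ[μ] ⋃ i ∈ s, P i) {f : α → F} {g : α → G}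
    {r q M : ℝ≥0∞} (hr : 1 ≤ r) (hrq : r ≤ q)
    (h : ∀ i ∈ s, eLpNorm f q (μ.restrict (P i)) ≤ M * eLpNorm g r (μ.restrict (P i))) :
    eLpNorm f q (μ.restrict U) ≤ M * eLpNorm g r (μ.restrict U) := by
  have hr0 : r ≠ 0 := (one_pos.trans_le hr).ne'
  have hq0 : q ≠ 0 := (one_pos.trans_le (hr.trans hrq)).ne'
  refine (eLpNorm_mono_measure f (Measure.restrict_mono_ae hU)).trans ?_
  by_cases hqt : q = ⊤
  · subst hqt
    rw [eLpNorm_exponent_top]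
    refine eLpNormEssSup_le_of_ae_enorm_bound ?_
    rw [ae_restrict_biUnion_finset_iff]
    intro i hi
    filter_upwards [enorm_ae_le_eLpNormEssSup f (μ.restrict (P i))] with x hx
    refine hx.trans (((eLpNorm_exponent_top (f := f)).symm.trans_le (h i hi)).trans ?_)
    gcongr
    exact hPU i hi
  · have hrt : r ≠ ⊤ := ne_top_of_le_ne_top hqt hrq
    have hrp : 0 < r.toReal := ENNReal.toReal_pos hr0 hrt
    have hqp : 0 < q.toReal := ENNReal.toReal_pos hq0 hqt
    have hqr : 1 ≤ q.toReal / r.toReal := by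
      rw [one_le_div hrp]
      exact ENNReal.toReal_mono hqt hrq
    rw [eLpNorm_eq_lintegral_rpow_enorm_toReal hq0 hqt, one_div, ENNReal.rpow_inv_le_iff hqp]
    calc ∫⁻ x in ⋃ i ∈ s, P i, ‖f x‖ₑ ^ q.toReal ∂μ
        = ∑ i ∈ s, ∫⁻ x in P i, ‖f x‖ₑ ^ q.toReal ∂μ := lintegral_biUnion_finset hd hP _
      _ ≤ ∑ i ∈ s, M ^ q.toReal *
            (∫⁻ x in P i, ‖g x‖ₑ ^ r.toReal ∂μ) ^ (q.toReal / r.toReal) := by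
          refine Finset.sum_le_sum fun i hi => ?_
          have hi := h i hi
          rw [eLpNorm_eq_lintegral_rpow_enorm_toReal hq0 hqt, one_div,
            ENNReal.rpow_inv_le_iff hqp, ENNReal.mul_rpow_of_nonneg _ _ hqp.le,
            eLpNorm_eq_lintegral_rpow_enorm_toReal hr0 hrt, ← ENNReal.rpow_mul,
            one_div_mul_eq_div] at hi
          exact hi
      _ ≤ M ^ q.toReal * (∑ i ∈ s, ∫⁻ x in P i, ‖g x‖ₑ ^ r.toReal ∂μ) ^
            (q.toReal / r.toReal) := by
          rw [← Finset.mul_sum]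
          gcongr
          exact sum_rpow_le_rpow_sum _ _ hqr
      _ ≤ M ^ q.toReal * (∫⁻ x in U, ‖g x‖ₑ ^ r.toReal ∂μ) ^ (q.toReal / r.toReal) := by
          gcongr
          rw [← lintegral_biUnion_finset hd hP]
          exact lintegral_mono_set (iUnion₂_subset hPU)
      _ = (M * eLpNorm g r (μ.restrict U)) ^ q.toReal := by
          rw [ENNReal.mul_rpow_of_nonneg _ _ hqp.le,
            eLpNorm_eq_lintegral_rpow_enorm_toReal hr0 hrt, ← ENNReal.rpow_mul,
            one_div_mul_eq_div]

end LpSums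

/-! ### Simplices -/

section Simplex

variable {d : ℕ} {v : Fin (d + 1) → Space d}

lemma exists_edgeEquiv (hv : AffineIndependent ℝ v) (i : Fin (d + 1)) :
    ∃ M : (Fin d → ℝ) ≃L[ℝ] Space d,
      ∀ x, M x = ∑ j, x j • (v (i.succAbove j) - v i) := by
  rw [affineIndependent_iff_linearIndependent_vsub ℝ v i] at hv
  have hli : LinearIndependent ℝ fun j : Fin d => v (i.succAbove j) - v i :=
    hv.comp (finSuccAboveEquiv i) (finSuccAboveEquiv i).injective
  rcases isEmpty_or_nonempty (Fin d) with he | he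
  · have hd : d = 0 := by
      by_contra h
      exact he.elim ⟨0, Nat.pos_of_ne_zero h⟩
    subst hd
    have e : (Fin 0 → ℝ) ≃L[ℝ] Space 0 := (EuclideanSpace.equiv (Fin 0) ℝ).symm
    exact ⟨e, fun x => Subsingleton.elim _ _⟩
  · let b := basisOfLinearIndependentOfCardEqFinrank hli (by simp)
    refine ⟨b.equivFun.symm.toContinuousLinearEquiv, fun x => ?_⟩
    change b.equivFun.symm x = _
    rw [Module.Basis.equivFun_symm_apply]
    simp [b]

lemma mem_convexHull_range_iff {x : Space d} :
    x ∈ convexHull ℝ (range v) ↔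
      ∃ w : Fin (d + 1) → ℝ, (∀ i, 0 ≤ w i) ∧ ∑ i, w i = 1 ∧ ∑ i, w i • v i = x := by
  constructor
  · intro hx
    let C : Set (Space d) :=
      {x | ∃ w : Fin (d + 1) → ℝ, (∀ i, 0 ≤ w i) ∧ ∑ i, w i = 1 ∧ ∑ i, w i • v i = x}
    have hsub : range v ⊆ C := by
      rintro _ ⟨i, rfl⟩
      refine ⟨Pi.single i 1, fun k => ?_, by simp, by simp [Pi.single_apply]⟩
      by_cases hk : k = i <;> simp [hk]
    have hconv : Convex ℝ C := by
      rintro _ ⟨w, hw0, hw1, rfl⟩ _ ⟨w', hw0', hw1', rfl⟩ a b ha hb hab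
      refine ⟨fun i => a * w i + b * w' i, fun i => ?_, ?_, ?_⟩
      · exact add_nonneg (mul_nonneg ha (hw0 i)) (mul_nonneg hb (hw0' i))
      · rw [Finset.sum_add_distrib, ← Finset.mul_sum, ← Finset.mul_sum, hw1, hw1']
        simpa using hab
      · simp only [add_smul, mul_smul, Finset.sum_add_distrib, Finset.smul_sum]
    exact convexHull_min hsub hconv hx
  · rintro ⟨w, h0, h1, rfl⟩
    exact (convex_convexHull ℝ _).sum_mem (fun i _ => h0 i) h1
      fun i _ => subset_convexHull ℝ _ (mem_range_self i)

lemma add_edge_mem_convexHull {i : Fin (d + 1)} {y : Fin d → ℝ} (h0 : ∀ j, 0 ≤ y j)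
    (h1 : ∑ j, y j ≤ 1) :
    v i + ∑ j, y j • (v (i.succAbove j) - v i) ∈ convexHull ℝ (range v) := by
  rw [mem_convexHull_range_iff]
  refine ⟨i.insertNth (1 - ∑ j, y j) y, fun k => ?_, ?_, ?_⟩
  · refine Fin.succAboveCases i ?_ (fun j => ?_) k
    · simpa using h1
    · simpa using h0 j
  · rw [Fin.sum_univ_succAbove _ i]
    simp
  · rw [Fin.sum_univ_succAbove _ i]
    simp [smul_sub, sub_smul, Finset.sum_smul]
    abel

lemma sum_smul_eq_add_edge {w : Fin (d + 1) → ℝ} (h1 : ∑ i, w i = 1) (i : Fin (d + 1)) :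
    ∑ k, w k • v k = v i + ∑ j, w (i.succAbove j) • (v (i.succAbove j) - v i) := by
  rw [Fin.sum_univ_succAbove _ i] at h1 ⊢
  rw [show w i = 1 - ∑ j, w (i.succAbove j) by linarith]
  simp [smul_sub, sub_smul, Finset.sum_smul]
  abel

end Simplex

/-! ### Subdivision of a simplex into parallelepipeds -/

section Cells

variable {d : ℕ}

/-- The equivalence `M` scaled by `1 / N`. -/
def scaleEquiv (M : (Fin d → ℝ) ≃L[ℝ] Space d) (N : ℕ) (hN : (N : ℝ)⁻¹ ≠ 0) :
    (Fin d → ℝ) ≃L[ℝ] Space d :=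
  M.trans (ContinuousLinearEquiv.smulLeft (Units.mk0 (N : ℝ)⁻¹ hN))

lemma scaleEquiv_apply (M : (Fin d → ℝ) ≃L[ℝ] Space d) (N : ℕ) (hN : (N : ℝ)⁻¹ ≠ 0)
    (x : Fin d → ℝ) : scaleEquiv M N hN x = (N : ℝ)⁻¹ • M x := rfl

open scoped Pointwise in
lemma volume_image_scaleEquiv (M : (Fin d → ℝ) ≃L[ℝ] Space d) (N : ℕ) (hN : (N : ℝ)⁻¹ ≠ 0) :
    volume (scaleEquiv M N hN '' Icc 0 1) =
      ENNReal.ofReal ((N : ℝ)⁻¹ ^ d) * volume (M '' Icc 0 1) := by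
  have : scaleEquiv M N hN '' Icc 0 1 = (N : ℝ)⁻¹ • (M '' Icc 0 1) := by
    rw [← image_smul, image_image]
    rfl
  rw [this, Measure.addHaar_smul_of_nonneg _ (by positivity)]
  simp

variable {v : Fin (d + 1) → Space d}

/-- Bounds the volume of the parallelepiped spanned by the edges at a vertex from below by that of
the simplex. -/
lemma convexHull_range_subset_parPiped {i : Fin (d + 1)} {M : (Fin d → ℝ) ≃L[ℝ] Space d}
    (hM : ∀ x, M x = ∑ j, x j • (v (i.succAbove j) - v i)) :
    convexHull ℝ (range v) ⊆ parPiped (v i) M := by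
  intro x hx
  obtain ⟨w, h0, h1, rfl⟩ := mem_convexHull_range_iff.1 hx
  refine ⟨fun j => w (i.succAbove j), ⟨fun j => h0 _, fun j => ?_⟩, ?_⟩
  · rw [Pi.one_apply, ← h1]
    exact Finset.single_le_sum (fun k _ => h0 k) (Finset.mem_univ _)
  · change v i + M _ = _
    rw [hM, sum_smul_eq_add_edge h1 i]

/-- For the sup norm on the domain, `M` is bounded by the sum of `d` edge lengths; the scaling by `1
/ N` with `d ≤ N` absorbs the factor `d`. -/
lemma norm_scaleEquiv_le {i : Fin (d + 1)} {M : (Fin d → ℝ) ≃L[ℝ] Space d}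
    (hM : ∀ x, M x = ∑ j, x j • (v (i.succAbove j) - v i)) {N : ℕ} (hN : (N : ℝ)⁻¹ ≠ 0)
    (hdN : d ≤ N) :
    ‖(scaleEquiv M N hN : (Fin d → ℝ) →L[ℝ] Space d)‖ ≤ Metric.diam (convexHull ℝ (range v)) := by
  refine ContinuousLinearMap.opNorm_le_bound _ Metric.diam_nonneg fun x => ?_
  change ‖(N : ℝ)⁻¹ • M x‖ ≤ _
  have hN0 : (0 : ℝ) < N := by
    have : (N : ℝ) ≠ 0 := by simpa using hN
    positivity
  rw [norm_smul, norm_inv, RCLike.norm_natCast, inv_mul_le_iff₀ hN0, hM, convexHull_diam]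
  calc ‖∑ j, x j • (v (i.succAbove j) - v i)‖
      ≤ ∑ j, ‖x j • (v (i.succAbove j) - v i)‖ := norm_sum_le _ _
    _ ≤ ∑ _j : Fin d, ‖x‖ * Metric.diam (range v) := by
        refine Finset.sum_le_sum fun j _ => ?_
        rw [norm_smul]
        gcongr
        · exact norm_le_pi_norm x j
        · rw [← dist_eq_norm]
          exact Metric.dist_le_diam_of_mem (finite_range v).isBounded (mem_range_self _)
            (mem_range_self _)
    _ = d * (Metric.diam (range v) * ‖x‖) := by
        rw [Finset.sum_const, Finset.card_univ, Fintype.card_fin, nsmul_eq_mul,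
          mul_comm ‖x‖]
    _ ≤ N * (Metric.diam (range v) * ‖x‖) := by
        have := Metric.diam_nonneg (s := range v)
        gcongr

/-- The coordinates of a point of the cell relative to the edges at `v i` sum to at most `∑ (k j +
1) / N`, attained at the far corner. -/
lemma parPiped_scaleEquiv_subset {i : Fin (d + 1)} {M : (Fin d → ℝ) ≃L[ℝ] Space d}
    (hM : ∀ x, M x = ∑ j, x j • (v (i.succAbove j) - v i)) {N : ℕ} (hN : (N : ℝ)⁻¹ ≠ 0)
    {k : Fin d → ℕ} (hk : ∑ j, (k j + 1) ≤ N) :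
    parPiped (v i + M fun j => (N : ℝ)⁻¹ * k j) (scaleEquiv M N hN) ⊆
      convexHull ℝ (range v) := by
  have hN0 : (0 : ℝ) < N := by
    have : (N : ℝ) ≠ 0 := by simpa using hN
    positivity
  rintro _ ⟨x, hx, rfl⟩
  have e : v i + M (fun j => (N : ℝ)⁻¹ * k j) + scaleEquiv M N hN x =
      v i + M (fun j => (N : ℝ)⁻¹ * (k j + x j)) := by
    rw [scaleEquiv_apply, ← map_smul, add_assoc, ← map_add]
    congr 2
    ext j
    simp [mul_add]
  change v i + M (fun j => (N : ℝ)⁻¹ * k j) + scaleEquiv M N hN x ∈ _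
  rw [e, hM]
  refine add_edge_mem_convexHull (fun j => ?_) ?_
  · have := hx.1 j
    simp only [Pi.zero_apply] at this
    positivity
  · rw [← Finset.mul_sum, inv_mul_le_iff₀ hN0, mul_one]
    calc ∑ j, ((k j : ℝ) + x j) ≤ ∑ j, ((k j : ℝ) + 1) := by
          refine Finset.sum_le_sum fun j _ => ?_
          have := hx.2 j
          simp only [Pi.one_apply] at this
          linarith
      _ ≤ N := by exact_mod_cast hk

/-- Every point of a simplex lies in one of the small parallelepipeds. -/
lemma exists_mem_parPiped_scaleEquiv {M : Fin (d + 1) → (Fin d → ℝ) ≃L[ℝ] Space d}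
    (hM : ∀ i x, M i x = ∑ j, x j • (v (i.succAbove j) - v i)) {N : ℕ} (hN : (N : ℝ)⁻¹ ≠ 0)
    (hNd : N = d * (d + 1)) {x : Space d} (hx : x ∈ convexHull ℝ (range v)) :
    ∃ (i : Fin (d + 1)) (k : Fin d → Fin (N + 1)), ∑ j, ((k j : ℕ) + 1) ≤ N ∧
      x ∈ parPiped (v i + M i fun j => (N : ℝ)⁻¹ * (k j : ℕ)) (scaleEquiv (M i) N hN) := by
  have hN0 : (0 : ℝ) < N := by
    have : (N : ℝ) ≠ 0 := by simpa using hN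
    positivity
  obtain ⟨w, h0, h1, rfl⟩ := mem_convexHull_range_iff.1 hx
  -- Some barycentric coordinate is at least the average. With that vertex as corner, the other
  -- coordinates sum to at most `1 - 1 / (d + 1)`.
  obtain ⟨i, hi⟩ : ∃ i, 1 / ((d : ℝ) + 1) ≤ w i := by
    by_contra! h
    have : ∑ i, w i < ∑ _i : Fin (d + 1), 1 / ((d : ℝ) + 1) :=
      Finset.sum_lt_sum_of_nonempty Finset.univ_nonempty fun i _ => h i
    rw [h1] at this
    simp at this
    rw [mul_inv_cancel₀ (by positivity)] at this
    exact lt_irrefl _ this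
  have hwi := h1
  rw [Fin.sum_univ_succAbove _ i] at hwi
  set y : Fin d → ℝ := fun j => w (i.succAbove j) with hy
  have hy0 : ∀ j, 0 ≤ N * y j := fun j => mul_nonneg hN0.le (h0 _)
  -- Passing to the far corner of the grid cell adds at most `d`; the room available is `N / (d +
  -- 1)`, which is `d` for this `N`.
  have hsum : ∑ j, ((⌊N * y j⌋₊ : ℝ) + 1) ≤ N := by
    calc ∑ j, ((⌊N * y j⌋₊ : ℝ) + 1) ≤ ∑ j, (N * y j + 1) := by
          gcongr with j
          exact Nat.floor_le (hy0 j)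
      _ = N * ∑ j, y j + d := by rw [Finset.sum_add_distrib, Finset.mul_sum]; simp
      _ ≤ N * (1 - 1 / ((d : ℝ) + 1)) + d := by
          gcongr
          linarith
      _ = N := by
          rw [hNd]
          push_cast
          field_simp
          ring
  have hsum' : ∑ j, (⌊N * y j⌋₊ + 1) ≤ N := by exact_mod_cast hsum
  have hlt : ∀ j, ⌊N * y j⌋₊ < N + 1 := by
    intro j
    have : ⌊N * y j⌋₊ + 1 ≤ N :=
      (Finset.single_le_sum (f := fun j => ⌊N * y j⌋₊ + 1) (fun _ _ => Nat.zero_le _)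
        (Finset.mem_univ j)).trans hsum'
    omega
  refine ⟨i, fun j => ⟨⌊N * y j⌋₊, hlt j⟩, hsum', fun j => N * y j - ⌊N * y j⌋₊,
    ⟨fun j => ?_, fun j => ?_⟩, ?_⟩
  · exact sub_nonneg.2 (Nat.floor_le (hy0 j))
  · have := Nat.lt_floor_add_one (N * y j)
    simp only [Pi.one_apply]
    linarith
  · simp only [scaleEquiv_apply]
    rw [← map_smul, add_assoc, ← map_add, hM, sum_smul_eq_add_edge h1 i]
    congr 2
    ext1 j
    congr 1
    simp only [Pi.add_apply, Pi.smul_apply, smul_eq_mul]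
    field_simp
    ring

end Cells

/-! ### Shape regular simplices -/

section ShapeRegular

variable {d : ℕ} {s : Finset (Space d)}

lemma isCompact_convexHull_finset (s : Finset (Space d)) :
    IsCompact (convexHull ℝ (s : Set (Space d))) :=
  s.finite_toSet.isCompact_convexHull ℝ

lemma exists_affineIndependent_range_eq (hcard : s.card = d + 1)
    (hs : AffineIndependent ℝ ((↑) : s → Space d)) :
    ∃ v : Fin (d + 1) → Space d, AffineIndependent ℝ v ∧ range v = s := by
  let e := s.equivFinOfCardEq hcard
  refine ⟨fun i => (e.symm i : Space d), hs.comp_embedding e.symm.toEmbedding, ?_⟩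
  ext x
  constructor
  · rintro ⟨i, rfl⟩
    exact (e.symm i).2
  · intro hx
    exact ⟨e ⟨x, hx⟩, by simp⟩

lemma openSimplex_nonempty (hcard : s.card = d + 1)
    (hs : AffineIndependent ℝ ((↑) : s → Space d)) : (openSimplex s).Nonempty := by
  obtain ⟨v, hv, hvs⟩ := exists_affineIndependent_range_eq hcard hs
  rw [openSimplex, interior_convexHull_nonempty_iff_affineSpan_eq_top, ← hvs,
    hv.affineSpan_eq_top_iff_card_eq_finrank_add_one]
  simp

/-- Two antipodal points of the ball realise its diameter. This bounds the set defining
`inballDiam`, so its `sSup` is a genuine supremum. -/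
lemma le_elemDiam_of_closedBall_subset (hd : 1 ≤ d) {t : ℝ} (ht : 0 ≤ t) {x : Space d}
    (h : Metric.closedBall x (t / 2) ⊆ convexHull ℝ (s : Set (Space d))) : t ≤ elemDiam s := by
  let e : Space d := EuclideanSpace.single ⟨0, hd⟩ 1
  have he : ‖e‖ = 1 := by simp [e]
  have h1 : x + (t / 2) • e ∈ Metric.closedBall x (t / 2) := by
    rw [mem_closedBall_iff_norm, add_sub_cancel_left, norm_smul, he, mul_one, Real.norm_eq_abs,
      abs_of_nonneg (by positivity)]
  have h2 : x - (t / 2) • e ∈ Metric.closedBall x (t / 2) := by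
    rw [mem_closedBall_iff_norm, sub_sub_cancel_left, norm_neg, norm_smul, he, mul_one,
      Real.norm_eq_abs, abs_of_nonneg (by positivity)]
  have h3 := Metric.dist_le_diam_of_mem (isCompact_convexHull_finset s).isBounded (h h1) (h h2)
  have h4 : dist (x + (t / 2) • e) (x - (t / 2) • e) = t := by
    rw [dist_eq_norm, show x + (t / 2) • e - (x - (t / 2) • e) = t • e by module, norm_smul, he,
      mul_one, Real.norm_eq_abs, abs_of_nonneg ht]
  rw [h4] at h3
  exact h3

/-- A shape regular simplex has volume comparable to `h_K ^ d`. -/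
lemma le_volume_convexHull (hd : 1 ≤ d) (hcard : s.card = d + 1)
    (hs : AffineIndependent ℝ ((↑) : s → Space d)) {γ₀ : ℝ}
    (hγ : elemDiam s / inballDiam s ≤ γ₀) :
    0 < γ₀ ∧ 0 < elemDiam s ∧
      ENNReal.ofReal ((elemDiam s / (4 * γ₀)) ^ d) * volume (Metric.ball (0 : Space d) 1) ≤
        volume (convexHull ℝ (s : Set (Space d))) := by
  obtain ⟨x, hx⟩ := openSimplex_nonempty hcard hs
  obtain ⟨ε, hε, hball⟩ := Metric.nhds_basis_closedBall.mem_iff.1 (isOpen_interior.mem_nhds hx)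
  have hball' : Metric.closedBall x (2 * ε / 2) ⊆ convexHull ℝ (s : Set (Space d)) := by
    rw [mul_div_cancel_left₀ _ two_ne_zero]
    exact hball.trans interior_subset
  set R := {t : ℝ | 0 ≤ t ∧ ∃ x : Space d,
    Metric.closedBall x (t / 2) ⊆ convexHull ℝ (s : Set (Space d))} with hR
  have hbdd : BddAbove R := ⟨elemDiam s, by
    rintro t ⟨ht, y, hy⟩
    exact le_elemDiam_of_closedBall_subset hd ht hy⟩
  have hmem : 2 * ε ∈ R := ⟨by positivity, x, hball'⟩
  -- Positivity rules out the default value `h / 0 = 0`, for which the shape bound would say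
  -- nothing.
  have hρ : 0 < inballDiam s := lt_of_lt_of_le (by positivity) (le_csSup hbdd hmem)
  have hh : 0 < elemDiam s := lt_of_lt_of_le (by positivity)
    (le_elemDiam_of_closedBall_subset hd (by positivity) hball')
  have hγ0 : 0 < γ₀ := lt_of_lt_of_le (div_pos hh hρ) hγ
  refine ⟨hγ0, hh, ?_⟩
  -- A ball of diameter `t > ρ_K / 2` avoids showing that the supremum is attained; its radius
  -- exceeds `ρ_K / 4 ≥ h_K / (4 γ₀)`.
  obtain ⟨t, ⟨ht0, y, hy⟩, ht⟩ := exists_lt_of_lt_csSup ⟨_, hmem⟩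
    (show inballDiam s / 2 < sSup R from half_lt_self hρ)
  have hle : elemDiam s / (4 * γ₀) ≤ t / 2 := by
    rw [div_le_iff₀ hρ] at hγ
    rw [div_le_iff₀ (by positivity)]
    nlinarith
  have hvol := Measure.addHaar_closedBall (volume : Measure (Space d)) y
    (show 0 ≤ t / 2 by positivity)
  rw [finrank_euclideanSpace_fin] at hvol
  calc _ ≤ ENNReal.ofReal ((t / 2) ^ d) * volume (Metric.ball (0 : Space d) 1) := by
        gcongr
    _ = volume (Metric.closedBall y (t / 2)) := hvol.symm
    _ ≤ _ := measure_mono hy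

/-- The scaled Sobolev inequality on shape regular simplices. -/
lemma IsCubeSobolevConst.exists_simplex {r q : ℝ≥0∞} {A : ℝ≥0}
    (hA : IsCubeSobolevConst d r q A) (hd : 1 ≤ d) (hr : 1 ≤ r) (hrt : r ≠ ⊤) (hrq : r ≤ q)
    (γ₀ : ℝ) :
    ∃ B : ℝ≥0, ∀ s : Finset (Space d), s.card = d + 1 →
      AffineIndependent ℝ ((↑) : s → Space d) → elemDiam s / inballDiam s ≤ γ₀ →
      ∀ (u : Space d → Space d) (g : Space d → Space d →L[ℝ] Space d),
      HasWeakGrad (openSimplex s) u g →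
      MemLp u r (volume.restrict (openSimplex s)) → MemLp g r (volume.restrict (openSimplex s)) →
      eLpNorm u q (volume.restrict (openSimplex s)) ≤
        B * ENNReal.ofReal (elemDiam s) ^ (-(d * expGap r q)) *
          (eLpNorm u r (volume.restrict (openSimplex s)) +
            ENNReal.ofReal (elemDiam s) * eLpNorm g r (volume.restrict (openSimplex s))) := by
  obtain ⟨N, hNd⟩ : ∃ N : ℕ, N = d * (d + 1) := ⟨_, rfl⟩
  have hN0 : 0 < N := by rw [hNd]; positivity
  have hN : (N : ℝ)⁻¹ ≠ 0 := by positivity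
  have hdN : d ≤ N := by rw [hNd]; exact Nat.le_mul_of_pos_right d (by omega)
  have hτ := expGap_nonneg hr hrq
  set c : ℝ≥0∞ := ENNReal.ofReal (((N : ℝ)⁻¹ / (4 * γ₀)) ^ d) *
    volume (Metric.ball (0 : Space d) 1) with hc
  let ι := Fin (d + 1) × (Fin d → Fin (N + 1))
  rcases le_or_gt γ₀ 0 with hγ0 | hγ0
  · refine ⟨0, fun s hcard hs hγ => ?_⟩
    exact absurd (le_volume_convexHull hd hcard hs hγ).1 hγ0.not_gt
  have hω : volume (Metric.ball (0 : Space d) 1) ≠ 0 :=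
    (Metric.measure_ball_pos volume _ one_pos).ne'
  have hc0 : c ≠ 0 := by
    refine mul_ne_zero ?_ hω
    rw [ENNReal.ofReal_ne_zero_iff]
    positivity
  -- The number of candidate cells times the cell constant at unit scale; no individual simplex
  -- enters.
  set D : ℝ≥0∞ := Fintype.card ι * (A * (2 ^ d * c⁻¹) ^ expGap r q) with hD
  have hDt : D ≠ ⊤ := by
    refine ENNReal.mul_ne_top (by simp) (ENNReal.mul_ne_top (by simp) ?_)
    refine ENNReal.rpow_ne_top_of_nonneg hτ (ENNReal.mul_ne_top (by simp) ?_)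
    exact ENNReal.inv_ne_top.2 hc0
  refine ⟨D.toNNReal, fun s hcard hs hγ u g h hur hgr => ?_⟩
  rw [ENNReal.coe_toNNReal hDt]
  obtain ⟨-, hh, hvol⟩ := le_volume_convexHull hd hcard hs hγ
  obtain ⟨v, hv, hvs⟩ := exists_affineIndependent_range_eq hcard hs
  choose M hM using exists_edgeEquiv hv
  set K := convexHull ℝ (s : Set (Space d)) with hK
  have hKv : K = convexHull ℝ (range v) := by rw [hK, hvs]
  set hE := ENNReal.ofReal (elemDiam s) with hhE
  have hE0 : hE ≠ 0 := by rw [hhE, ENNReal.ofReal_ne_zero_iff]; exact hh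
  let P : ι → Set (Space d) := fun p =>
    parPiped (v p.1 + M p.1 fun j => (N : ℝ)⁻¹ * (p.2 j : ℕ)) (scaleEquiv (M p.1) N hN)
  let I : Finset ι := Finset.univ.filter fun p => ∑ j, ((p.2 j : ℕ) + 1) ≤ N
  have hcover : openSimplex s ⊆ ⋃ p ∈ I, P p := by
    intro x hx
    have hxK : x ∈ convexHull ℝ (range v) := hKv ▸ interior_subset hx
    obtain ⟨i, k, hk, hx⟩ := exists_mem_parPiped_scaleEquiv hM hN hNd hxK
    exact mem_iUnion₂.2 ⟨(i, k), by simpa [I] using hk, hx⟩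
  have hKfin : volume (interior K) ≠ ⊤ :=
    ((measure_mono interior_subset).trans_lt (isCompact_convexHull_finset s).measure_lt_top).ne
  -- A cell has `N ^ (-d)` times the volume of the edge parallelepiped, which contains the shape
  -- regular simplex.
  have hκ : ∀ i, hE ^ d * c ≤ volume (scaleEquiv (M i) N hN '' Icc 0 1) := by
    intro i
    have e : hE ^ d * c = ENNReal.ofReal ((N : ℝ)⁻¹ ^ d) *
        (ENNReal.ofReal ((elemDiam s / (4 * γ₀)) ^ d) *
          volume (Metric.ball (0 : Space d) 1)) := by
      rw [hc, hhE, ← ENNReal.ofReal_pow hh.le, ← mul_assoc, ← mul_assoc,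
        ← ENNReal.ofReal_mul (by positivity), ← ENNReal.ofReal_mul (by positivity)]
      congr 2
      rw [← mul_pow, ← mul_pow]
      congr 1
      ring
    rw [e, volume_image_scaleEquiv, ← volume_parPiped (v i)]
    gcongr
    refine hvol.trans (measure_mono ?_)
    exact hKv ▸ convexHull_range_subset_parPiped (hM i)
  have hH : ∀ i, ‖(scaleEquiv (M i) N hN : (Fin d → ℝ) →L[ℝ] Space d)‖ₑ ≤ hE := by
    intro i
    rw [← ofReal_norm]
    refine ENNReal.ofReal_le_ofReal ?_
    have := norm_scaleEquiv_le (hM i) hN hdN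
    rwa [hvs] at this
  have hcell : ∀ p ∈ I, eLpNorm u q (volume.restrict (P p)) ≤
      A * (2 ^ d * (hE ^ d * c)⁻¹) ^ expGap r q *
        (eLpNorm u r (volume.restrict (openSimplex s)) +
          hE * eLpNorm g r (volume.restrict (openSimplex s))) := by
    intro p hp
    refine hA.eLpNorm_parPiped_le_of_hasWeakGrad hr hrt hrq hKfin h hur hgr _ _ ?_ (hκ _) (hH _)
    rw [hKv]
    exact parPiped_scaleEquiv_subset (hM _) hN (by simpa [I] using hp)
  have hscale : (2 ^ d * (hE ^ d * c)⁻¹) ^ expGap r q =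
      (2 ^ d * c⁻¹) ^ expGap r q * hE ^ (-(d * expGap r q)) := by
    rw [ENNReal.mul_inv (Or.inl (pow_ne_zero _ hE0)) (Or.inl (by simp [hhE])), mul_comm _ c⁻¹,
      ← mul_assoc, ENNReal.mul_rpow_of_nonneg _ _ hτ]
    congr 1
    rw [← ENNReal.rpow_natCast, ← ENNReal.rpow_neg, ← ENNReal.rpow_mul, neg_mul]
  calc eLpNorm u q (volume.restrict (openSimplex s))
      ≤ eLpNorm u q (volume.restrict (⋃ p ∈ I, P p)) :=
        eLpNorm_mono_measure _ (Measure.restrict_mono hcover le_rfl)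
    _ ≤ ∑ p ∈ I, eLpNorm u q (volume.restrict (P p)) :=
        eLpNorm_restrict_biUnion_le _ (hr.trans hrq) _ _
    _ ≤ ∑ _p ∈ I, A * (2 ^ d * (hE ^ d * c)⁻¹) ^ expGap r q *
        (eLpNorm u r (volume.restrict (openSimplex s)) +
          hE * eLpNorm g r (volume.restrict (openSimplex s))) := Finset.sum_le_sum hcell
    _ ≤ Fintype.card ι * (A * (2 ^ d * (hE ^ d * c)⁻¹) ^ expGap r q *
        (eLpNorm u r (volume.restrict (openSimplex s)) +
          hE * eLpNorm g r (volume.restrict (openSimplex s)))) := by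
        rw [Finset.sum_const, nsmul_eq_mul]
        gcongr
        exact Finset.card_le_univ I
    _ = _ := by
        rw [hscale, hD]
        ring

end ShapeRegular

/-! ### Triangulations -/

section Triangulation

variable {d : ℕ} {Ω : Set (Space d)} {T : Geometry.SimplicialComplex ℝ (Space d)}

lemma IsTriangulation.finite_facets (hT : IsTriangulation Ω T) : T.facets.Finite :=
  hT.finite.subset fun _ hs => hs.1

lemma IsTriangulation.closure_eq (hT : IsTriangulation Ω T) :
    closure Ω = ⋃ s ∈ T.facets, convexHull ℝ (s : Set (Space d)) := by
  rw [← hT.space_eq]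
  apply Subset.antisymm
  · intro x hx
    obtain ⟨s, hs, hxs⟩ := Geometry.SimplicialComplex.mem_space_iff.1 hx
    obtain ⟨t, hst, ht⟩ := hT.finite.exists_le_maximal hs
    refine mem_iUnion₂.2 ⟨t, ⟨ht.1, fun u hu htu => ?_⟩, convexHull_mono ?_ hxs⟩
    · exact le_antisymm htu (ht.2 hu htu)
    · exact_mod_cast hst
  · exact iUnion₂_subset fun s hs => Geometry.SimplicialComplex.convexHull_subset_space hs.1

lemma IsTriangulation.isCompact_closure (hT : IsTriangulation Ω T) : IsCompact (closure Ω) := by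
  rw [hT.closure_eq]
  exact hT.finite_facets.isCompact_biUnion fun s _ => isCompact_convexHull_finset s

lemma IsTriangulation.elemDiam_le (hT : IsTriangulation Ω T) {s : Finset (Space d)}
    (hs : s ∈ T.facets) : elemDiam s ≤ Metric.diam (closure Ω) := by
  refine Metric.diam_mono ?_ hT.isCompact_closure.isBounded
  rw [hT.closure_eq]
  exact subset_biUnion_of_mem (u := fun s : Finset (Space d) => convexHull ℝ (s : Set (Space d))) hs

/-- The discarded element boundaries are frontiers of convex sets, hence null. -/
lemma IsTriangulation.ae_le_iUnion (hT : IsTriangulation Ω T) :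
    Ω ≤ᵐ[volume] ⋃ s ∈ hT.finite_facets.toFinset, openSimplex s := by
  have h1 : (⋃ s ∈ hT.finite_facets.toFinset, openSimplex s) =ᵐ[volume]
      ⋃ s ∈ hT.finite_facets.toFinset, convexHull ℝ (s : Set (Space d)) :=
    Filter.EventuallyEq.countable_bUnion (Finset.countable_toSet _) fun s _ =>
      interior_ae_eq_of_null_frontier ((convex_convexHull ℝ _).addHaar_frontier volume)
  have h2 : Ω ⊆ ⋃ s ∈ hT.finite_facets.toFinset, convexHull ℝ (s : Set (Space d)) := by
    refine subset_closure.trans (hT.closure_eq.subset.trans (le_of_eq ?_))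
    simp
  exact h2.eventuallyLE.trans h1.symm.le

lemma interior_convexHull_eq_empty_of_card_le {t : Finset (Space d)} (ht : t.card ≤ d) :
    interior (convexHull ℝ (t : Set (Space d))) = ∅ := by
  classical
  by_contra h
  have hspan := affineSpan_eq_top_of_nonempty_interior (nonempty_iff_ne_empty.2 h)
  rcases t.eq_empty_or_nonempty with rfl | hne
  · simp at h
  · obtain ⟨n, hn⟩ := Nat.exists_eq_succ_of_ne_zero (Finset.card_pos.2 hne).ne'
    have h1 := finrank_vectorSpan_image_finset_le ℝ (id : Space d → Space d) t hn
    rw [Finset.image_id, ← direction_affineSpan, hspan, AffineSubspace.direction_top, finrank_top,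
      finrank_euclideanSpace_fin] at h1
    omega

/-- Two elements meet in the hull of their common vertices. By maximality distinct facets share at
most `d` of them, and such a hull has empty interior. -/
lemma IsTriangulation.pairwiseDisjoint (hT : IsTriangulation Ω T) :
    T.facets.PairwiseDisjoint openSimplex := by
  classical
  intro s hs t ht hst
  rw [Function.onFun, disjoint_iff_inter_eq_empty]
  have hsub : openSimplex s ∩ openSimplex t ⊆
      interior (convexHull ℝ ((s ∩ t : Finset (Space d)) : Set (Space d))) := by
    rw [openSimplex, openSimplex, ← interior_inter, Finset.coe_inter]
    exact interior_mono (T.inter_subset_convexHull hs.1 ht.1)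
  have hcard : (s ∩ t).card ≤ d := by
    have hlt : (s ∩ t).card < s.card := by
      refine Finset.card_lt_card (Finset.ssubset_iff_subset_ne.2
        ⟨Finset.inter_subset_left, fun h => hst ?_⟩)
      exact hs.2 ht.1 (Finset.inter_eq_left.1 h)
    rw [hT.card_eq s hs] at hlt
    omega
  rw [interior_convexHull_eq_empty_of_card_le hcard] at hsub
  exact subset_empty_iff.1 hsub

lemma measurableSet_openSimplex (s : Finset (Space d)) : MeasurableSet (openSimplex s) :=
  isOpen_interior.measurableSet

end Triangulation

/-! ### Weak gradients -/

section WeakGrad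

variable {d : ℕ} {U V : Set (Space d)} {z w : Space d → Space d}
  {g : Space d → Space d →L[ℝ] Space d}

lemma HasWeakGrad.weakGrad (h : HasWeakGrad U z g) : HasWeakGrad U z (weakGrad U z) := by
  have hex : ∃ g, HasWeakGrad U z g := ⟨g, h⟩
  rw [DivReconstruction.weakGrad, dif_pos hex]
  exact hex.choose_spec

lemma HasWeakGrad.mono (h : HasWeakGrad U z g) (hVU : V ⊆ U) : HasWeakGrad V z g where
  loc := h.loc.mono_set hVU
  loc_grad := h.loc_grad.mono_set hVU
  parts φ hφ v := by
    have hp := h.parts φ ⟨hφ.smooth, hφ.compact, hφ.supp.trans hVU⟩ v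
    have h0 : ∀ x ∉ V, φ x = 0 := fun x hx =>
      image_eq_zero_of_notMem_tsupport fun h => hx (hφ.supp h)
    have h1 : ∀ x ∉ V, fderiv ℝ φ x v = 0 := fun x hx => by
      rw [image_eq_zero_of_notMem_tsupport (f := fderiv ℝ φ)
        fun h => hx (hφ.supp (tsupport_fderiv_subset ℝ h))]
      rfl
    rw [setIntegral_eq_integral_of_forall_compl_eq_zero fun x hx => by
        rw [h1 x fun h => hx (hVU h), zero_smul],
      setIntegral_eq_integral_of_forall_compl_eq_zero fun x hx => by
        rw [h0 x fun h => hx (hVU h), zero_smul]] at hp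
    rw [setIntegral_eq_integral_of_forall_compl_eq_zero fun x hx => by rw [h1 x hx, zero_smul],
      setIntegral_eq_integral_of_forall_compl_eq_zero fun x hx => by rw [h0 x hx, zero_smul]]
    exact hp

end WeakGrad

/-! ### Sobolev exponents -/

/-- For `r = d` the given `q` may be smaller than `r`, while summation over elements needs `r ≤ q'`;
then `max q r` is used. The gap satisfies `d τ = 1` for `r < d`, `d τ = 1 - d / q'` for `r = d` and
`d τ = d / r` for `r > d`. -/
lemma IsSobolevExponent.exists_ge {d : ℕ} (hd : 2 ≤ d) {r q : ℝ≥0∞} (hr : 1 ≤ r)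
    (hq : IsSobolevExponent d r q) :
    1 ≤ q ∧ ∃ q', q ≤ q' ∧ r ≤ q' ∧ IsSobolevExponent d r q' ∧ d * expGap r q' ≤ 1 := by
  have hd0 : (0 : ℝ) < d := by positivity
  have hdE : (d : ℝ≥0∞) ≠ 0 := by positivity
  rcases lt_trichotomy r d with h | h | h
  · have hrt : r ≠ ⊤ := h.ne_top
    lift r to ℝ≥0 using hrt
    have hrd : r < (d : ℝ≥0) := by exact_mod_cast h
    have hrd' : (r : ℝ) < d := by exact_mod_cast hrd
    have hr1 : 1 ≤ r := by exact_mod_cast hr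
    have hr0 : (0 : ℝ) < r := one_pos.trans_le hr1
    have hsub : (0 : ℝ) < d - r := sub_pos.2 hrd'
    have hq' : q = ((d * r / (d - r) : ℝ≥0) : ℝ≥0∞) := by
      rw [hq.1 h, ENNReal.coe_div (tsub_pos_of_lt hrd).ne']
      simp
    have hval : ((d * r / (d - r) : ℝ≥0) : ℝ) = d * r / (d - r) := by
      rw [NNReal.coe_div, NNReal.coe_sub hrd.le]
      push_cast
      rfl
    have hrq : (r : ℝ≥0∞) ≤ q := by
      rw [hq', ENNReal.coe_le_coe, ← NNReal.coe_le_coe, hval, le_div_iff₀ hsub]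
      nlinarith
    refine ⟨hr.trans hrq, q, le_rfl, hrq, hq, le_of_eq ?_⟩
    rw [expGap, hq']
    simp only [one_div, ENNReal.toReal_inv, ENNReal.coe_toReal, hval]
    field_simp
    ring
  · obtain ⟨hq1, hqt⟩ := hq.2.1 h
    refine ⟨hq1, max q r, le_max_left _ _, le_max_right _ _, ⟨fun h' => absurd h h'.ne, fun _ =>
      ⟨hq1.trans (le_max_left _ _), max_lt hqt ?_⟩, fun h' => absurd h h'.ne'⟩, ?_⟩
    · rw [h]; exact ENNReal.natCast_lt_top d
    · have : (1 / r).toReal = 1 / d := by rw [h]; simp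
      rw [expGap, this, mul_sub, mul_one_div_cancel hd0.ne', sub_le_self_iff]
      positivity
  · have hqt := hq.2.2 h
    subst hqt
    refine ⟨le_top, ⊤, le_rfl, le_top, hq, ?_⟩
    have : (1 / r).toReal ≤ 1 / d := by
      have h1 : (1 / r) ≤ 1 / (d : ℝ≥0∞) := by gcongr
      refine (ENNReal.toReal_mono (by simpa using (by omega : d ≠ 0)) h1).trans ?_
      simp
    rw [expGap]
    simp only [one_div, ENNReal.inv_top, ENNReal.toReal_zero, sub_zero] at this ⊢
    calc (d : ℝ) * (r⁻¹).toReal ≤ d * (d : ℝ)⁻¹ := by gcongr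
      _ = 1 := mul_inv_cancel₀ hd0.ne'

/-- `B` is a constant of the scaled Sobolev inequality on simplices with shape constant `γ₀`. -/
def IsSimplexSobolevConst (d : ℕ) (γ₀ : ℝ) (r q : ℝ≥0∞) (B : ℝ≥0) : Prop :=
  ∀ s : Finset (Space d), s.card = d + 1 →
    AffineIndependent ℝ ((↑) : s → Space d) → elemDiam s / inballDiam s ≤ γ₀ →
    ∀ (u : Space d → Space d) (g : Space d → Space d →L[ℝ] Space d),
    HasWeakGrad (openSimplex s) u g →
    MemLp u r (volume.restrict (openSimplex s)) → MemLp g r (volume.restrict (openSimplex s)) →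
    eLpNorm u q (volume.restrict (openSimplex s)) ≤
      B * ENNReal.ofReal (elemDiam s) ^ (-(d * expGap r q)) *
        (eLpNorm u r (volume.restrict (openSimplex s)) +
          ENNReal.ofReal (elemDiam s) * eLpNorm g r (volume.restrict (openSimplex s)))

lemma exists_isSimplexSobolevConst {d : ℕ} (hd : 2 ≤ d) (γ₀ : ℝ) {r q : ℝ≥0∞} (hr : 1 ≤ r)
    (hrq : r ≤ q) (hq : IsSobolevExponent d r q) : ∃ B, IsSimplexSobolevConst d γ₀ r q B := by
  -- Here `q = ⊤` as well and there is nothing to gain; mollification is needed only for finite `r`.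
  by_cases hrt : r = ⊤
  · subst hrt
    obtain rfl := top_le_iff.1 hrq
    refine ⟨1, fun s _ _ _ u g _ _ _ => ?_⟩
    simp [expGap]
  · obtain ⟨A, hA⟩ := exists_eLpNorm_cube_le (G := Space d) hd hr hrt hq
    have hA' : IsCubeSobolevConst d r q A := hA
    exact hA'.exists_simplex (by omega) hr hrt hrq γ₀

/-! ### Embedding on a triangulated set and the elementwise error estimate -/

section Estimates

variable {d : ℕ} {Ω : Set (Space d)} {T : Geometry.SimplicialComplex ℝ (Space d)} {γ₀ : ℝ}
  {r q : ℝ≥0∞} {B : ℝ≥0}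

lemma IsTriangulation.elemDiam_pos (hT : IsTriangulation Ω T) (hd : 1 ≤ d)
    {s : Finset (Space d)} (hs : s ∈ T.facets) (hγ : elemDiam s / inballDiam s ≤ γ₀) :
    0 < elemDiam s :=
  (le_volume_convexHull hd (hT.card_eq s hs) (T.indep hs.1) hγ).2.1

/-- The Sobolev embedding on a triangulated set. -/
lemma IsTriangulation.exists_eLpNorm_le (hT : IsTriangulation Ω T) (hd : 1 ≤ d)
    (hγ : ∀ s ∈ T.facets, elemDiam s / inballDiam s ≤ γ₀)
    (hB : IsSimplexSobolevConst d γ₀ r q B) (hq : 1 ≤ q) :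
    ∃ c : ℝ≥0, ∀ (z : Space d → Space d) (g : Space d → Space d →L[ℝ] Space d),
      HasWeakGrad Ω z g → MemLp z r (volume.restrict Ω) → MemLp g r (volume.restrict Ω) →
      eLpNorm z q (volume.restrict Ω) ≤
        c * (eLpNorm z r (volume.restrict Ω) + eLpNorm g r (volume.restrict Ω)) := by
  set F := hT.finite_facets.toFinset with hF
  have hFT : ∀ s ∈ F, s ∈ T.facets := fun s hs => by simpa [hF] using hs
  -- These constants involve negative powers of the element diameters, which is harmless for a fixed
  -- triangulation.
  let a : Finset (Space d) → ℝ≥0∞ := fun s =>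
    B * ENNReal.ofReal (elemDiam s) ^ (-(d * expGap r q)) * max 1 (ENNReal.ofReal (elemDiam s))
  have ha : ∑ s ∈ F, a s ≠ ⊤ := by
    refine ENNReal.sum_ne_top.2 fun s hs => ?_
    have hpos := hT.elemDiam_pos hd (hFT s hs) (hγ s (hFT s hs))
    refine ENNReal.mul_ne_top (ENNReal.mul_ne_top ENNReal.coe_ne_top ?_) (by simp)
    exact ENNReal.rpow_ne_top_of_ne_zero (by simpa using hpos) ENNReal.ofReal_ne_top
  refine ⟨(∑ s ∈ F, a s).toNNReal, fun z g h hz hg => ?_⟩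
  rw [ENNReal.coe_toNNReal ha]
  calc eLpNorm z q (volume.restrict Ω)
      ≤ eLpNorm z q (volume.restrict (⋃ s ∈ F, openSimplex s)) :=
        eLpNorm_mono_measure _ (Measure.restrict_mono_ae hT.ae_le_iUnion)
    _ ≤ ∑ s ∈ F, eLpNorm z q (volume.restrict (openSimplex s)) :=
        eLpNorm_restrict_biUnion_le _ hq _ _
    _ ≤ ∑ s ∈ F, a s * (eLpNorm z r (volume.restrict Ω) + eLpNorm g r (volume.restrict Ω)) := by
        refine Finset.sum_le_sum fun s hs => ?_
        have hsT := hFT s hs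
        have hsub := hT.interior_subset s hsT
        have hle : volume.restrict (openSimplex s) ≤ volume.restrict Ω :=
          Measure.restrict_mono hsub le_rfl
        refine (hB s (hT.card_eq s hsT) (T.indep hsT.1) (hγ s hsT) z g (h.mono hsub)
          (hz.mono_measure hle) (hg.mono_measure hle)).trans ?_
        simp only [a]
        rw [mul_assoc _ (max 1 _), mul_add (max 1 _)]
        gcongr
        · exact (eLpNorm_mono_measure _ hle).trans (le_mul_of_one_le_left zero_le (le_max_left _ _))
        · exact le_max_right _ _
    _ = _ := by rw [Finset.sum_mul]

/-- An elementwise first order consistency error gains the full Sobolev exponent. -/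
lemma IsTriangulation.eLpNorm_le_of_consistent (hT : IsTriangulation Ω T) (hd : 1 ≤ d)
    (hγ : ∀ s ∈ T.facets, elemDiam s / inballDiam s ≤ γ₀)
    (hB : IsSimplexSobolevConst d γ₀ r q B) (hr : 1 ≤ r) (hrq : r ≤ q)
    (hgap : d * expGap r q ≤ 1) {w : Space d → Space d}
    (hwm : AEStronglyMeasurable w (volume.restrict Ω))
    (hw : ∀ s ∈ T.facets, ∃ g, HasWeakGrad (openSimplex s) w g)
    {G : Space d → Space d →L[ℝ] Space d} (hG : eLpNorm G r (volume.restrict Ω) ≠ ⊤) {c : ℝ≥0}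
    (h0 : ∀ s ∈ T.facets, eLpNorm w r (volume.restrict (openSimplex s)) ≤
      c * ENNReal.ofReal (elemDiam s) * eLpNorm G r (volume.restrict (openSimplex s)))
    (h1 : ∀ s ∈ T.facets, eLpNorm (weakGrad (openSimplex s) w) r
        (volume.restrict (openSimplex s)) ≤ c * eLpNorm G r (volume.restrict (openSimplex s))) :
    eLpNorm w q (volume.restrict Ω) ≤
      2 * B * c * ENNReal.ofReal (Metric.diam (closure Ω)) ^ (1 - d * expGap r q) *
        eLpNorm G r (volume.restrict Ω) := by
  set F := hT.finite_facets.toFinset with hF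
  have hFT : ∀ s ∈ F, s ∈ T.facets := fun s hs => by simpa [hF] using hs
  refine eLpNorm_le_mul_of_forall_restrict_le (s := F) (P := openSimplex)
    (fun s _ => measurableSet_openSimplex s) (fun s hs t ht hst => ?_)
    (fun s hs => hT.interior_subset s (hFT s hs)) hT.ae_le_iUnion hr hrq fun s hs => ?_
  · exact hT.pairwiseDisjoint (hFT s hs) (hFT t ht) hst
  have hsT := hFT s hs
  have hle : volume.restrict (openSimplex s) ≤ volume.restrict Ω :=
    Measure.restrict_mono (hT.interior_subset s hsT) le_rfl
  have hGs : eLpNorm G r (volume.restrict (openSimplex s)) < ⊤ :=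
    (eLpNorm_mono_measure _ hle).trans_lt hG.lt_top
  obtain ⟨g, hg⟩ := hw s hsT
  have hwg := hg.weakGrad
  have hwr : MemLp w r (volume.restrict (openSimplex s)) :=
    ⟨hwm.mono_measure hle, (h0 s hsT).trans_lt
      (ENNReal.mul_lt_top (ENNReal.mul_lt_top ENNReal.coe_lt_top ENNReal.ofReal_lt_top) hGs)⟩
  have hgr : MemLp (weakGrad (openSimplex s) w) r (volume.restrict (openSimplex s)) :=
    ⟨hwg.loc_grad.aestronglyMeasurable, (h1 s hsT).trans_lt
      (ENNReal.mul_lt_top ENNReal.coe_lt_top hGs)⟩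
  have hpos := hT.elemDiam_pos hd hsT (hγ s hsT)
  set h := ENNReal.ofReal (elemDiam s) with hh
  have hh0 : h ≠ 0 := by rw [hh, ENNReal.ofReal_ne_zero_iff]; exact hpos
  have hht : h ≠ ⊤ := ENNReal.ofReal_ne_top
  calc eLpNorm w q (volume.restrict (openSimplex s))
      ≤ B * h ^ (-(d * expGap r q)) * (eLpNorm w r (volume.restrict (openSimplex s)) +
          h * eLpNorm (weakGrad (openSimplex s) w) r (volume.restrict (openSimplex s))) :=
        hB s (hT.card_eq s hsT) (T.indep hsT.1) (hγ s hsT) w _ hwg hwr hgr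
    _ ≤ B * h ^ (-(d * expGap r q)) *
          (c * h * eLpNorm G r (volume.restrict (openSimplex s)) +
            h * (c * eLpNorm G r (volume.restrict (openSimplex s)))) := by
        gcongr
        · exact h0 s hsT
        · exact h1 s hsT
    _ = 2 * B * c * (h ^ (-(d * expGap r q)) * h) *
          eLpNorm G r (volume.restrict (openSimplex s)) := by ring
    _ = 2 * B * c * h ^ (1 - d * expGap r q) *
          eLpNorm G r (volume.restrict (openSimplex s)) := by
        nth_rw 2 [← ENNReal.rpow_one h]
        rw [← ENNReal.rpow_add _ _ hh0 hht, neg_add_eq_sub]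
    -- The exponent `1 - d τ` is nonnegative by `hgap`, so enlarging the diameter enlarges the
    -- power.
    _ ≤ _ := by
        gcongr
        exact ENNReal.ofReal_le_ofReal (hT.elemDiam_le hsT)

end Estimates

/-- Without a weak gradient on the element, `weakGrad` would be the default `0` and the consistency
bound on it would carry no information. The part from `Xh` has one on all of `Ω`, the part from `Zh`
on each element. -/
lemma exists_hasWeakGrad_sub_reconstruction {d : ℕ} {Ω : TopologicalSpace.Opens (Space d)}
    {T : Geometry.SimplicialComplex ℝ (Space d)} (hT : IsTriangulation (Ω : Set (Space d)) T)
    {p : ℝ≥0∞} {Xh Zh : Submodule ℝ (VField (Ω : Set (Space d)))} (hXh : Xh ≤ sobolevSpace Ω p)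
    (hZh : IsDivConforming Ω T Zh) (z : sobolevSpace Ω p)
    {y : VField (Ω : Set (Space d))} (hy : y ∈ Xh ⊔ Zh) {s : Finset (Space d)}
    (hs : s ∈ T.facets) :
    ∃ g, HasWeakGrad (openSimplex s) ((z.1 : Space d → Space d) - (y : Space d → Space d)) g := by
  have hsub := hT.interior_subset s hs
  obtain ⟨a, ha, b, hb, rfl⟩ := Submodule.mem_sup.1 hy
  obtain ⟨-, gz, hgz, -⟩ := z.2
  obtain ⟨-, ga, hga, -⟩ := hXh ha
  obtain ⟨-, gb, hgb, -⟩ := hZh.memSobolev b hb s hs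
  refine ⟨_, ((hgz.mono hsub).add (((hga.mono hsub).add hgb).smul (-1))).congr ?_⟩
  filter_upwards [ae_restrict_of_ae_restrict_of_subset hsub (AEEqFun.coeFn_add a b)] with x hx
  rw [Pi.sub_apply, hx]
  simp [sub_eq_add_neg, add_comm]

end

end DivReconstruction

/-! ### Assembly of the stability estimate -/

theorem mainTheorem4 (d : ℕ) (hd : d = 2 ∨ d = 3)
    (Ω : TopologicalSpace.Opens (Space d))
    (γ₀ : ℝ) (C : ℝ≥0∞ → ℝ≥0)
    (r q : ℝ≥0∞) (hr : 1 ≤ r) (hq : IsSobolevExponent d r q) :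
    ∃ c : ℝ≥0,
      ∀ (T : Geometry.SimplicialComplex ℝ (Space d)),
      IsTriangulation (Ω : Set (Space d)) T →
      (∀ s ∈ T.facets,
        elemDiam s / inballDiam s ≤ γ₀) →
      ∀ (p : ℝ≥0∞), 1 ≤ p →
      ∀ (m k : ℕ)
        (Xh Zh : Submodule ℝ (VField (Ω : Set (Space d))))
        (Yh : Submodule ℝ
          (Space d →ₘ[volume.restrict (Ω : Set (Space d))] ℝ)),
      (∀ z ∈ Xh, MemContPoly Ω T m z) →
      Xh ≤ sobolevSpace Ω p →
      (∀ y ∈ Yh, MemBrokenPoly Ω T k y) →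
      IsDivConforming Ω T Zh →
      ∀ S : sobolevSpace Ω p →ₗ[ℝ]
        (Xh ⊔ Zh : Submodule ℝ (VField (Ω : Set (Space d)))),
      IsReconstruction Ω T p Xh Zh Yh C S →
      ∀ z : sobolevSpace Ω p, z.1 ∈ sobolevSpace Ω r →
        eLpNorm (S z).1 q (volume.restrict (Ω : Set (Space d))) ≤
          c * sobolevNorm Ω r z.1 := by
  have hd2 : 2 ≤ d := by omega
  have hd1 : 1 ≤ d := by omega
  -- Fix a reference triangulation `T₀`, chosen from `Ω` and `γ₀` alone, for the embedding of `z`;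
  -- if none exists, the claim is vacuous. It also makes `closure Ω` compact.
  by_cases hex : ∃ T : Geometry.SimplicialComplex ℝ (Space d),
      IsTriangulation (Ω : Set (Space d)) T ∧ ∀ s ∈ T.facets, elemDiam s / inballDiam s ≤ γ₀
  swap
  · exact ⟨0, fun T hT hγ => absurd ⟨T, hT, hγ⟩ hex⟩
  obtain ⟨T₀, hT₀, hγ₀⟩ := hex
  obtain ⟨hq1, q', hqq', hrq', hq', hgap⟩ := hq.exists_ge hd2 hr
  obtain ⟨B, hB⟩ := exists_isSimplexSobolevConst hd2 γ₀ hr hrq' hq'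
  obtain ⟨c₀, hc₀⟩ := hT₀.exists_eLpNorm_le hd1 hγ₀ hB (hq1.trans hqq')
  set μ := volume.restrict (Ω : Set (Space d)) with hμ
  have hΩ : μ univ ≠ ⊤ := by
    rw [hμ, Measure.restrict_apply_univ]
    exact ((measure_mono subset_closure).trans_lt hT₀.isCompact_closure.measure_lt_top).ne
  set D : ℝ≥0∞ := 2 * B * C r *
    ENNReal.ofReal (Metric.diam (closure (Ω : Set (Space d)))) ^ (1 - d * expGap r q') with hD
  have hDt : D ≠ ⊤ :=
    ENNReal.mul_ne_top (by finiteness)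
      (ENNReal.rpow_ne_top_of_nonneg (by linarith) ENNReal.ofReal_ne_top)
  -- Hölder factor for returning from `q'` to `q`. For an infinite exponent, `toReal` is `0` and `1
  -- / 0 = 0` is the correct reciprocal.
  set V : ℝ≥0∞ := μ univ ^ (1 / q.toReal - 1 / q'.toReal) with hV
  have hVt : V ≠ ⊤ := by
    refine ENNReal.rpow_ne_top_of_nonneg ?_ hΩ
    rw [sub_nonneg]
    rcases eq_or_ne q' ⊤ with rfl | h'
    · simp
    · have hqt : q ≠ ⊤ := ne_top_of_le_ne_top h' hqq'
      exact one_div_le_one_div_of_le (ENNReal.toReal_pos (one_pos.trans_le hq1).ne' hqt)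
        (ENNReal.toReal_mono h' hqq')
  -- The added `1` keeps `c` nonzero, so that `c * ⊤ = ⊤` below.
  set c : ℝ≥0∞ := (c₀ + D) * V + 1 with hc
  have hct : c ≠ ⊤ := by finiteness
  refine ⟨c.toNNReal, fun T hT hγ p _ m k Xh Zh Yh _ hXh _ hZh S hS z hz => ?_⟩
  rw [ENNReal.coe_toNNReal hct]
  obtain ⟨-, gz, hgz, -⟩ := z.2
  have hG := hgz.weakGrad
  set G := weakGrad (Ω : Set (Space d)) z.1 with hGdef
  -- `G` is a chosen weak gradient, possibly not the one witnessing membership in `W^{1,r}`. If its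
  -- norm is infinite the estimate is trivial, so uniqueness of weak gradients is not needed.
  by_cases hGt : eLpNorm G r μ = ⊤
  · rw [sobolevNorm, ← hGdef, hGt, add_top, ENNReal.mul_top (by simp [hc])]
    exact le_top
  have hGr : MemLp G r μ := ⟨hG.loc_grad.aestronglyMeasurable, Ne.lt_top hGt⟩
  have hz' : MemLp z.1 r μ := hz.1
  have hzq := hc₀ z.1 G hG hz' hGr
  set w : Space d → Space d := (z.1 : Space d → Space d) - ((S z).1 : Space d → Space d) with hw
  have hSm : AEStronglyMeasurable ((S z).1 : Space d → Space d) μ :=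
    AEEqFun.aestronglyMeasurable _
  have hwm : AEStronglyMeasurable w μ := hz'.1.sub hSm
  have hwq : eLpNorm w q' μ ≤ D * eLpNorm G r μ := by
    refine hT.eLpNorm_le_of_consistent hd1 hγ hB hr hrq' hgap hwm
      (fun s hs => exists_hasWeakGrad_sub_reconstruction hT hXh hZh z (S z).2 hs) hGt ?_ ?_
    · intro s hs
      refine le_trans (le_of_eq (eLpNorm_congr_ae ?_)) (hS.consistent_zero r hr s hs z hz)
      exact ae_restrict_of_ae_restrict_of_subset (hT.interior_subset s hs)
        (AEEqFun.coeFn_sub z.1 (S z).1).symm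
    · intro s hs
      exact le_add_self.trans (hS.consistent_one r hr s hs z hz)
  have hSw : ((S z).1 : Space d → Space d) = (z.1 : Space d → Space d) - w := by
    rw [hw, sub_sub_cancel]
  calc eLpNorm (S z).1 q μ ≤ eLpNorm (S z).1 q' μ * V :=
        eLpNorm_le_eLpNorm_mul_rpow_measure_univ hqq' hSm
    _ ≤ (eLpNorm z.1 q' μ + eLpNorm w q' μ) * V := by
        gcongr
        nth_rw 1 [hSw]
        exact eLpNorm_sub_le hz'.1 hwm (hq1.trans hqq')
    _ ≤ (c₀ * (eLpNorm z.1 r μ + eLpNorm G r μ) + D * (eLpNorm z.1 r μ + eLpNorm G r μ)) * V := by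
        gcongr
        exact hwq.trans (by gcongr; exact le_add_self)
    _ = (c₀ + D) * V * (eLpNorm z.1 r μ + eLpNorm G r μ) := by ring
    _ ≤ c * (eLpNorm z.1 r μ + eLpNorm G r μ) := by
        gcongr
        exact le_self_add
    _ = c * sobolevNorm Ω r z.1 := rfl
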